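/- Let $n\ge 1$ be an integer and let $p\ge 2-\frac{1}{2n}$. For a differential form $\omega$ of degree $a$ on a smooth compact $k$-manifold $M$ (with measurable coefficients), write $\omega\in W^{1,p}(\bigwedge^{a}M)$ if in all smooth local coordinates $x:U\to B^k(0,1)$ that extend smoothly to a neighbourhood of $\overline U$ the coefficients of $\omega$ belong to the Sobolev space $W^{1,p}(B^k(0,1))$. The exterior derivative $d\omega$ is then defined almost everywhere, through the weak partial derivatives of the coefficients. The sphere $\mathbb S^{4n-1}\subset\mathbb R^{4n}$ carries its standard Riemannian metric and its orientation as the boundary of the unit ball. (1) Let $\omega_1,\omega_2\in W^{1,p}(\bigwedge^{2n-1}\mathbb S^{4n-1})$ and assume that $d\omega_1=d\omega_2$ almost everywhere. Then the forms $\omega_1\wedge d\omega_1$ and $\omega_2\wedge d\omega_2$ are integrable on $\mathbb S^{4n-1}$ and $$\int_{\mathbb S^{4n-1}}\omega_1\wedge d\omega_1=\int_{\mathbb S^{4n-1}}\omega_2\wedge d\omega_2 .$$ (2) In particular, let $f:\mathbb S^{4n-1}\to\mathbb R^m$ be a Lipschitz map with $\operatorname{rank} df\le 2n$ almost everywhere,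 and let $\alpha$ be a smooth $2n$-form on $\mathbb R^m$. Then the generalized Hopf invariant $$\mathcal H_\alpha f=\int_{\mathbb S^{4n-1}}\omega\wedge d\omega$$ does not depend on the choice of $\omega\in W^{1,p}(\bigwedge^{2n-1}\mathbb S^{4n-1})$ with $d\omega=f^*\alpha$ almost everywhere: the form $\omega\wedge d\omega$ is integrable for every such $\omega$, and any two such $\omega$ give the same value of the integral. -/

import Mathlib

open MeasureTheory Metric Set
open scoped Manifold ContDiff NNReal ENNReal

noncomputable section

namespace SobolevForms

/-! ### The scalar Sobolev space `W^{1,p}` on an open subset of `ℝ^k` -/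

/-- `g` is the weak partial derivative `∂_i u` on the open set `U ⊆ ℝ^k`:
both are locally integrable on `U` and `∫_U u ∂_i φ = - ∫_U g φ` for all `φ ∈ C_c^∞(U)`. -/
def HasWeakPartial {k : ℕ} (U : Set (EuclideanSpace ℝ (Fin k))) (i : Fin k)
    (u g : EuclideanSpace ℝ (Fin k) → ℝ) : Prop :=
  LocallyIntegrableOn u U ∧ LocallyIntegrableOn g U ∧
    ∀ φ : EuclideanSpace ℝ (Fin k) → ℝ, ContDiff ℝ ∞ φ → HasCompactSupport φ → tsupport φ ⊆ U →
      ∫ y in U, u y * fderiv ℝ φ y (EuclideanSpace.single i 1) = -∫ y in U, g y * φ y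

/-- The Sobolev space `W^{1,p}(U)`: `u` and all its weak first partial derivatives are in
`L^p(U)`. -/
def MemW1 {k : ℕ} (p : ℝ≥0∞) (U : Set (EuclideanSpace ℝ (Fin k)))
    (u : EuclideanSpace ℝ (Fin k) → ℝ) : Prop :=
  MemLp u p (volume.restrict U) ∧
    ∀ i : Fin k, ∃ g : EuclideanSpace ℝ (Fin k) → ℝ,
      HasWeakPartial U i u g ∧ MemLp g p (volume.restrict U)

/-! ### Differential forms on a smooth manifold -/

section Manifold

variable {k : ℕ} {M : Type*} [TopologicalSpace M] [ChartedSpace (EuclideanSpace ℝ (Fin k)) M]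

/-- A (not necessarily continuous) differential form of degree `a` on the `k`-dimensional
manifold `M`: an alternating `a`-linear form on every tangent space. -/
abbrev DForm (k : ℕ) (M : Type*) [TopologicalSpace M] [ChartedSpace (EuclideanSpace ℝ (Fin k)) M]
    (a : ℕ) : Type _ :=
  (x : M) → TangentSpace (𝓡 k) x [⋀^Fin a]→ₗ[ℝ] ℝ

/-- The admissible local coordinate systems `x : U → B(0,1)`: smooth charts `e` of `M`, used on
`U = e⁻¹(B(0,1))` only, such that the closed unit ball is still contained in `e.target` (so that
the coordinates extend smoothly to a neighbourhood of the closure of `U`). -/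
def IsCoord (e : OpenPartialHomeomorph M (EuclideanSpace ℝ (Fin k))) : Prop :=
  e ∈ IsManifold.maximalAtlas (𝓡 k) ∞ M ∧ closedBall 0 1 ⊆ e.target

/-- The coefficient `w_{I_1,…,I_a} ∘ e⁻¹` of the form `w` in the coordinates `e`: the value of `w`
on the coordinate vector fields `∂/∂x_{I_1}, …, ∂/∂x_{I_a}`. -/
def coef {a : ℕ} (e : OpenPartialHomeomorph M (EuclideanSpace ℝ (Fin k))) (w : DForm k M a)
    (I : Fin a → Fin k) (y : EuclideanSpace ℝ (Fin k)) : ℝ :=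
  w (e.symm y) fun j =>
    mfderiv (𝓡 k) (𝓡 k) e.symm y
      (EuclideanSpace.single (I j) (1 : ℝ) : EuclideanSpace ℝ (Fin k))

/-- `w ∈ W^{1,p}(⋀^a M)`: in all admissible local coordinates the coefficients
`w_{i_1 < ⋯ < i_a}` are in `W^{1,p}(B(0,1))`. -/
def FormMemW1 {a : ℕ} (p : ℝ≥0∞) (w : DForm k M a) : Prop :=
  ∀ e : OpenPartialHomeomorph M (EuclideanSpace ℝ (Fin k)), IsCoord e →
    ∀ I : Fin a ↪o Fin k, MemW1 p (ball 0 1) (coef e w I)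

/-- `dw = ζ` almost everywhere: in all admissible local coordinates, and for all
`J_0 < ⋯ < J_a`, the coefficient `ζ_{J_0,…,J_a}` equals
`∑_j (-1)^j ∂_{J_j} w_{J_0,…,J_{j-1},J_{j+1},…,J_a}` a.e., with weak partial derivatives. -/
def HasWeakExtDeriv {a b : ℕ} (h : a + 1 = b) (w : DForm k M a) (ζ : DForm k M b) : Prop :=
  ∀ e : OpenPartialHomeomorph M (EuclideanSpace ℝ (Fin k)), IsCoord e →
    ∀ J : Fin (a + 1) ↪o Fin k, ∃ g : Fin (a + 1) → EuclideanSpace ℝ (Fin k) → ℝ,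
      (∀ j, HasWeakPartial (ball 0 1) (J j) (coef e w fun i => J (j.succAbove i)) (g j)) ∧
      ∀ᵐ y ∂(volume.restrict (ball (0 : EuclideanSpace ℝ (Fin k)) 1)),
        coef e ζ (fun j => J (Fin.cast h.symm j)) y = ∑ j : Fin (a + 1), (-1) ^ (j : ℕ) * g j y

/-- The wedge product of differential forms (the sum over shuffles, so that
`dx_1 ∧ ⋯ ∧ dx_c` is `1` on the coordinate vectors). -/
def wedge {a b c : ℕ} (h : a + b = c) (w : DForm k M a) (ζ : DForm k M b) : DForm k M c :=
  fun x => ((LinearMap.mul' ℝ ℝ).compAlternatingMap ((w x).domCoprod (ζ x))).domDomCongr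
    (finSumFinEquiv.trans (finCongr h))

/-- The pullback `f^*α` of a form `α` on `ℝ^m` under `f : M → ℝ^m`. It is meaningful at the points
where `f` is differentiable, hence a.e. for Lipschitz maps. -/
def pullback {m a : ℕ} (f : M → EuclideanSpace ℝ (Fin m))
    (α : EuclideanSpace ℝ (Fin m) → EuclideanSpace ℝ (Fin m) [⋀^Fin a]→L[ℝ] ℝ) : DForm k M a :=
  fun x => (α (f x)).toAlternatingMap.compLinearMap
    (mvfderiv (𝓡 k) f x : TangentSpace (𝓡 k) x →L[ℝ] EuclideanSpace ℝ (Fin m)).toLinearMap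

end Manifold

/-! ### Integration of top degree forms over the sphere -/

/-- The unit sphere `S^k` in `ℝ^{k+1}`. -/
abbrev Sph (k : ℕ) : Type := sphere (0 : EuclideanSpace ℝ (Fin (k + 1))) 1

/-- The standard surface measure on `S^k`. -/
def surf (k : ℕ) : Measure (Sph k) := (volume : Measure (EuclideanSpace ℝ (Fin (k + 1)))).toSphere

/-- The differential of the inclusion `S^k ⊆ ℝ^{k+1}`. -/
def dIncl {k : ℕ} (x : Sph k) : TangentSpace (𝓡 k) x →L[ℝ] EuclideanSpace ℝ (Fin (k + 1)) :=
  mvfderiv (𝓡 k) (Subtype.val : Sph k → EuclideanSpace ℝ (Fin (k + 1))) x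

/-- The Riemannian volume form of `S^k`, oriented as the boundary of the ball:
`vol_x(v_1,…,v_k) = det(x, v_1, …, v_k)`. -/
def sphereVol (k : ℕ) : DForm k (Sph k) k := fun x =>
  (((EuclideanSpace.basisFun (Fin (k + 1)) ℝ).toBasis.det).curryLeft
    (x : EuclideanSpace ℝ (Fin (k + 1)))).compLinearMap (dIncl x).toLinearMap

/-- The standard basis of the model space, as a basis of the tangent space at `x`. -/
def stdFrame {k : ℕ} (x : Sph k) (i : Fin k) : TangentSpace (𝓡 k) x :=
  (EuclideanSpace.single i (1 : ℝ) : EuclideanSpace ℝ (Fin k))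

/-- The function `h` with `η = h · vol`, for a form `η` of top degree on `S^k`
(see `eq_density_mul_vol`). -/
def density {k : ℕ} (η : DForm k (Sph k) k) (x : Sph k) : ℝ :=
  η x (stdFrame x) / sphereVol k x (stdFrame x)

/-- `η ∈ L^1(⋀^k S^k)`. -/
def IntegrableForm {k : ℕ} (η : DForm k (Sph k) k) : Prop := Integrable (density η) (surf k)

/-- `∫_{S^k} η`. -/
def integralForm {k : ℕ} (η : DForm k (Sph k) k) : ℝ := ∫ x, density η x ∂(surf k)

theorem sphereVol_stdFrame_ne_zero {k : ℕ} (x : Sph k) : sphereVol k x (stdFrame x) ≠ 0 := by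
  have : Fact (Module.finrank ℝ (EuclideanSpace ℝ (Fin (k + 1))) = k + 1) :=
    ⟨finrank_euclideanSpace_fin⟩
  have hinj : Function.Injective (dIncl x) := injective_mvfderiv_subtypeVal_sphere x
  have hrange : (dIncl x).range = (Submodule.span ℝ {(x : EuclideanSpace ℝ (Fin (k + 1)))})ᗮ :=
    range_mvfderiv_subtypeVal x
  have hstd : LinearIndependent ℝ (stdFrame x) := by
    have h := (EuclideanSpace.basisFun (Fin k) ℝ).toBasis.linearIndependent
    have h' : ⇑(EuclideanSpace.basisFun (Fin k) ℝ).toBasis = fun i : Fin k =>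
        (EuclideanSpace.single i (1 : ℝ) : EuclideanSpace ℝ (Fin k)) := by
      ext i; simp
    rw [h'] at h
    exact h
  have hli : LinearIndependent ℝ (fun i => dIncl x (stdFrame x i)) :=
    hstd.map' (dIncl x).toLinearMap (LinearMap.ker_eq_bot.2 hinj)
  have hx : (x : EuclideanSpace ℝ (Fin (k + 1))) ∉
      Submodule.span ℝ (Set.range fun i => dIncl x (stdFrame x i)) := by
    intro hmem
    have hle : Submodule.span ℝ (Set.range fun i => dIncl x (stdFrame x i)) ≤
        (Submodule.span ℝ {(x : EuclideanSpace ℝ (Fin (k + 1)))})ᗮ := by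
      rw [← hrange, Submodule.span_le]
      rintro _ ⟨i, rfl⟩
      exact ⟨_, rfl⟩
    have h0 := Submodule.mem_orthogonal_singleton_iff_inner_right.1 (hle hmem)
    have h1 : ‖(x : EuclideanSpace ℝ (Fin (k + 1)))‖ = 1 := by simp
    rw [inner_self_eq_zero] at h0
    rw [h0] at h1
    simp at h1
  have hcons : LinearIndependent ℝ (Fin.cons (x : EuclideanSpace ℝ (Fin (k + 1)))
      (fun i => dIncl x (stdFrame x i)) : Fin (k + 1) → EuclideanSpace ℝ (Fin (k + 1))) :=
    linearIndependent_finCons.2 ⟨hli, hx⟩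
  have hunit := ((EuclideanSpace.basisFun (Fin (k + 1)) ℝ).toBasis.is_basis_iff_det).1
    ⟨hcons, hcons.span_eq_top_of_card_eq_finrank' (by simp)⟩
  exact hunit.ne_zero

theorem eq_density_mul_vol {k : ℕ} (η : DForm k (Sph k) k) (x : Sph k)
    (v : Fin k → TangentSpace (𝓡 k) x) : η x v = density η x * sphereVol k x v := by
  let b : Module.Basis (Fin k) ℝ (TangentSpace (𝓡 k) x) :=
    (EuclideanSpace.basisFun (Fin k) ℝ).toBasis
  have hb : ⇑b = stdFrame x := by
    ext1 i
    have h : (EuclideanSpace.basisFun (Fin k) ℝ).toBasis i = EuclideanSpace.single i (1 : ℝ) := by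
      simp
    exact h
  have h1 := congrArg (fun f => f v) ((η x).eq_smul_basis_det b)
  have h2 := congrArg (fun f => f v) ((sphereVol k x).eq_smul_basis_det b)
  simp only [hb, AlternatingMap.smul_apply, smul_eq_mul] at h1 h2
  rw [h1, h2, density, ← mul_assoc, div_mul_cancel₀ _ (sphereVol_stdFrame_ne_zero x)]

end SobolevForms

end

open SobolevForms

/-!
Put `η = ω₁ - ω₂`. Since `dω₁ = dω₂` almost everywhere, `ω₁ ∧ dω₁ - ω₂ ∧ dω₂ = η ∧ dω₁` with `η`
weakly closed, so that formally `η ∧ dω₁ = ± d(η ∧ ω₁)` and the claim is Stokes' theorem. The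
forms are only of class `W^{1,p}`, and what makes this legitimate is the exponent. With
`k = 4n - 1` and `p = 2 - 1/(2n) = k/(2n)`, the Sobolev conjugate `q` of `p`, given by
`1/q = 1/p - 1/k`, satisfies `1/p + 1/q = 1` (`criticalExponents`). Hence a product of a function
of class `W^{1,p}` and of a weak derivative in `L^p` is locally integrable, and the product rule
`∫ χ u ∂ᵢv + ∫ χ ∂ᵢu v + ∫ ∂ᵢχ u v = 0` holds for `u`, `v` in `W^{1,p}` and test functions `χ`: it
follows by mollification from Hölder's inequality and the Sobolev inequality
(`HasWeakGradient.memLp_sobolev`, `HasWeakGradient.integral_product_rule`). A larger `p` reduces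
to the critical one, as the coordinate balls have finite volume.

In a coordinate ball, the pointwise identities `∑ᵢ dxᵢ ∧ ∂ᵢη ∧ ξ = 0` for closed `η`
(`sum_wedgeAt_eq_zero`) and `∑ᵢ dxᵢ ∧ η ∧ ∂ᵢξ = ± η ∧ dξ` (`exists_sum_wedgeAt_eq`) turn the
product rule into `± ∫ χ η ∧ dξ + ∫ dχ ∧ η ∧ ξ = 0` (`IsSobolevForm.integral_wedge_add`).
Integrals over the sphere are computed in a chart by `IsCoord.exists_integral_eq`, which rests on
the change of variables in the cone over a coordinate patch (`IsCoord.surf_image`). This gives the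
same formula for smooth functions `χ` on the sphere with support in a coordinate patch
(`IsCoord.integralForm_wedge_add`). Both terms are linear in `χ`, so summation over a finite
partition of unity leaves `∫ η ∧ dξ = 0`, because the differentials of the functions of the
partition add up to zero (`integralForm_wedge_of_criticalExponents`).

The second part is the first one for two forms with the same weak exterior derivative `f^*α`.
-/

namespace SobolevForms

open Filter Topology
open scoped Pointwise

variable {k : ℕ}

/-! ### Mollification -/

section Mollify

variable {E : Type*} [NormedAddCommGroup E] [InnerProductSpace ℝ E] [FiniteDimensional ℝ E]
  [MeasurableSpace E] [BorelSpace E]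

/-- Translations act continuously on `L^p`, for `p < ∞`. -/
theorem tendsto_eLpNorm_translate_sub {p : ℝ≥0∞} (hp1 : 1 ≤ p) (hp : p ≠ ⊤) {f : E → ℝ}
    (hf : MemLp f p volume) :
    Tendsto (fun t : E => eLpNorm (fun x => f (x - t) - f x) p volume) (𝓝 0) (𝓝 0) := by
  have : Fact (1 ≤ p) := ⟨hp1⟩
  have : Fact (p ≠ ⊤) := ⟨hp⟩
  have hcont : Continuous fun t : E => DomAddAct.mk (-t) +ᵥ hf.toLp f :=
    (continuous_vadd (M := Eᵈᵃᵃ) (X := Lp ℝ p (volume : Measure E))).comp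
      ((DomAddAct.mkHomeomorph.continuous.comp continuous_neg).prodMk continuous_const)
  have h := (hcont.tendsto 0).edist (tendsto_const_nhds (x := hf.toLp f))
  simp only [neg_zero, DomAddAct.mk_zero, zero_vadd, edist_self] at h
  refine h.congr fun t => ?_
  rw [DomAddAct.mk_vadd_toLp, Lp.edist_toLp_toLp]
  congr 1
  ext x
  simp [sub_eq_neg_add]

/-- Jensen's inequality for the power `p` and the probability density `φ`. -/
theorem lintegral_mul_rpow_le {α : Type*} [MeasurableSpace α] {μ : Measure α} {φ g : α → ℝ≥0∞}
    (hφ : Measurable φ) (hg : Measurable g) (h1 : ∫⁻ t, φ t ∂μ = 1)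
    {p : ℝ} (hp1 : 1 ≤ p) :
    (∫⁻ t, φ t * g t ∂μ) ^ p ≤ ∫⁻ t, φ t * g t ^ p ∂μ := by
  have hprob : IsProbabilityMeasure (μ.withDensity φ) := ⟨by simpa using h1⟩
  have h := eLpNorm'_le_eLpNorm'_of_exponent_le (f := g) zero_lt_one hp1 (μ.withDensity φ)
    hg.aestronglyMeasurable
  have hp0 : 0 < p := zero_lt_one.trans_le hp1
  simp only [eLpNorm', enorm_eq_self, ENNReal.rpow_one, div_one, one_div] at h
  rw [lintegral_withDensity_eq_lintegral_mul _ hφ hg,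
    lintegral_withDensity_eq_lintegral_mul _ hφ (hg.pow_const p)] at h
  calc _ ≤ ((∫⁻ t, φ t * g t ^ p ∂μ) ^ p⁻¹) ^ p := ENNReal.rpow_le_rpow h hp0.le
    _ = _ := by rw [← ENNReal.rpow_mul, inv_mul_cancel₀ hp0.ne', ENNReal.rpow_one]

/-- The standard mollifiers, with support of radius `1 / (j + 1)`. -/
noncomputable def mollifierBump (E : Type*) [NormedAddCommGroup E] [InnerProductSpace ℝ E] (j : ℕ) :
    ContDiffBump (0 : E) where
  rIn := 1 / (2 * ((j : ℝ) + 1))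
  rOut := 1 / ((j : ℝ) + 1)
  rIn_pos := by positivity
  rIn_lt_rOut := by
    apply one_div_lt_one_div_of_lt <;> have : (0 : ℝ) ≤ j := j.cast_nonneg
    · positivity
    · linarith

/-- The mollification of `f` at scale `1 / (j + 1)`. -/
noncomputable def mollify (j : ℕ) (f : E → ℝ) : E → ℝ :=
  convolution ((mollifierBump E j).normed volume) f (ContinuousLinearMap.lsmul ℝ ℝ) volume

theorem mollify_apply (j : ℕ) (f : E → ℝ) (x : E) :
    mollify j f x = ∫ t, (mollifierBump E j).normed volume t * f (x - t) := rfl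

/-- Mollification moves `f` in `L^p` at most as far as the translations by the vectors in the
support of the mollifier do. -/
theorem eLpNorm_mollify_sub_le {p : ℝ≥0∞} (hp1 : 1 ≤ p) (hp : p ≠ ⊤) {f : E → ℝ}
    (hf : MemLp f p volume) (j : ℕ) {ε : ℝ≥0∞}
    (hε : ∀ t ∈ ball (0 : E) (1 / ((j : ℝ) + 1)),
      eLpNorm (fun x => f (x - t) - f x) p volume ≤ ε) :
    eLpNorm (mollify j f - f) p volume ≤ ε := by
  wlog hfm : Measurable f generalizing f
  · obtain ⟨f', hf'm, hff'⟩ := hf.1.aemeasurable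
    have h1 : mollify j f = mollify j f' := by
      funext x
      exact congrFun (convolution_congr _ (EventuallyEq.refl _ _) hff') x
    have h2 : MemLp f' p volume := (memLp_congr_ae hff').1 hf
    have h3 : eLpNorm (mollify j f - f) p volume = eLpNorm (mollify j f' - f') p volume := by
      rw [h1]
      exact eLpNorm_congr_ae ((EventuallyEq.refl _ _).sub hff')
    rw [h3]
    refine this h2 (fun t ht => ?_) hf'm
    refine le_trans (le_of_eq ?_) (hε t ht)
    refine eLpNorm_congr_ae ?_
    have h4 : (fun x => f (x - t)) =ᵐ[volume] fun x => f' (x - t) :=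
      (measurePreserving_sub_right volume t).quasiMeasurePreserving.ae_eq_comp hff'
    filter_upwards [h4, hff'] with x hx1 hx2
    rw [hx1, hx2]
  set φ := (mollifierBump E j).normed volume with hφdef
  have hφ0 : ∀ t, 0 ≤ φ t := fun t => (mollifierBump E j).nonneg_normed t
  have hφint : Integrable φ volume := (mollifierBump E j).integrable_normed
  have hφm : Measurable φ := (mollifierBump E j).continuous_normed.measurable
  have hφ1 : ∫⁻ t, ‖φ t‖ₑ = 1 := by
    have := (mollifierBump E j).integral_normed (μ := volume)
    rw [← ofReal_integral_norm_eq_lintegral_enorm hφint]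
    simp only [Real.norm_of_nonneg (hφ0 _)]
    rw [this]; simp
  have hp0 : p ≠ 0 := (zero_lt_one.trans_le hp1).ne'
  have hpr : 1 ≤ p.toReal := by
    rw [← ENNReal.toReal_one]; exact ENNReal.toReal_mono hp hp1
  have hprpos : 0 < p.toReal := zero_lt_one.trans_le hpr
  have hloc : LocallyIntegrable f volume := hf.locallyIntegrable hp1
  have hpt : ∀ x, ‖(mollify j f - f) x‖ₑ ≤ ∫⁻ t, ‖φ t‖ₑ * ‖f (x - t) - f x‖ₑ := by
    intro x
    have hi : Integrable (fun t => φ t * f (x - t)) volume :=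
      (HasCompactSupport.convolutionExists_left (L := ContinuousLinearMap.lsmul ℝ ℝ)
        (mollifierBump E j).hasCompactSupport_normed
        (mollifierBump E j).continuous_normed hloc x)
    have h1 : (mollify j f - f) x = ∫ t, φ t * (f (x - t) - f x) := by
      simp only [mul_sub, Pi.sub_apply, mollify_apply]
      rw [integral_sub hi (hφint.mul_const _), integral_mul_const,
        (mollifierBump E j).integral_normed, one_mul]
    rw [h1]
    refine (enorm_integral_le_lintegral_enorm _).trans (le_of_eq ?_)
    simp only [enorm_mul]
  have hmeas : Measurable (fun z : E × E => ‖f (z.1 - z.2) - f z.1‖ₑ) := by fun_prop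
  rw [eLpNorm_eq_lintegral_rpow_enorm_toReal hp0 hp, one_div,
    ENNReal.rpow_inv_le_iff hprpos]
  calc ∫⁻ x, ‖(mollify j f - f) x‖ₑ ^ p.toReal
      ≤ ∫⁻ x, ∫⁻ t, ‖φ t‖ₑ * ‖f (x - t) - f x‖ₑ ^ p.toReal := by
        refine lintegral_mono fun x => ?_
        refine (ENNReal.rpow_le_rpow (hpt x) hprpos.le).trans ?_
        exact lintegral_mul_rpow_le (by fun_prop) (by fun_prop) hφ1 hpr
    _ = ∫⁻ t, ∫⁻ x, ‖φ t‖ₑ * ‖f (x - t) - f x‖ₑ ^ p.toReal := by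
        refine lintegral_lintegral_swap ?_
        refine Measurable.aemeasurable ?_
        unfold Function.uncurry
        exact ((hφm.comp measurable_snd).enorm).mul (hmeas.pow_const _)
    _ ≤ ∫⁻ t, ‖φ t‖ₑ * ε ^ p.toReal := by
        refine lintegral_mono fun t => ?_
        dsimp only
        rw [lintegral_const_mul _ (by fun_prop)]
        by_cases ht : t ∈ ball (0 : E) (1 / ((j : ℝ) + 1))
        · gcongr
          have h := hε t ht
          rwa [eLpNorm_eq_lintegral_rpow_enorm_toReal hp0 hp, one_div,
            ENNReal.rpow_inv_le_iff hprpos] at h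
        · have : φ t = 0 := by
            have h2 := (mollifierBump E j).support_normed_eq (μ := volume)
            by_contra hne
            exact ht (h2 ▸ (Function.mem_support.2 hne))
          simp [this]
    _ = ε ^ p.toReal := by
        rw [lintegral_mul_const _ hφm.enorm, hφ1, one_mul]

theorem tendsto_eLpNorm_mollify_sub {p : ℝ≥0∞} (hp1 : 1 ≤ p) (hp : p ≠ ⊤) {f : E → ℝ}
    (hf : MemLp f p volume) :
    Tendsto (fun j => eLpNorm (mollify j f - f) p volume) atTop (𝓝 0) := by
  rw [ENNReal.tendsto_nhds_zero]
  intro ε hε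
  have h := ENNReal.tendsto_nhds_zero.1 (tendsto_eLpNorm_translate_sub hp1 hp hf) ε hε
  obtain ⟨r, hr, hball⟩ := Metric.eventually_nhds_iff_ball.1 h
  have h0 := tendsto_one_div_add_atTop_nhds_zero_nat (𝕜 := ℝ)
  filter_upwards [h0.eventually (gt_mem_nhds hr)] with j hj
  exact eLpNorm_mollify_sub_le hp1 hp hf j fun t ht => hball t (ball_subset_ball hj.le ht)

theorem contDiff_mollify (j : ℕ) {f : E → ℝ} (hf : LocallyIntegrable f volume) :
    ContDiff ℝ ∞ (mollify j f) :=
  HasCompactSupport.contDiff_convolution_left _ (mollifierBump E j).hasCompactSupport_normed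
    (mollifierBump E j).contDiff_normed hf

theorem hasCompactSupport_mollify (j : ℕ) {f : E → ℝ} (hf : HasCompactSupport f) :
    HasCompactSupport (mollify j f) :=
  HasCompactSupport.convolution _ (mollifierBump E j).hasCompactSupport_normed hf

end Mollify

/-- Mollification commutes with weak partial derivatives. -/
theorem fderiv_mollify {k : ℕ} (j : ℕ) {i : Fin k} {u g : EuclideanSpace ℝ (Fin k) → ℝ}
    (h : HasWeakPartial univ i u g) (x : EuclideanSpace ℝ (Fin k)) :
    fderiv ℝ (mollify j u) x (EuclideanSpace.single i 1) = mollify j g x := by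
  obtain ⟨hu, hg, hw⟩ := h
  rw [locallyIntegrableOn_univ] at hu hg
  set b := mollifierBump (EuclideanSpace ℝ (Fin k)) j
  have hd := HasCompactSupport.hasFDerivAt_convolution_left (ContinuousLinearMap.lsmul ℝ ℝ)
    (b.hasCompactSupport_normed (μ := volume)) (b.contDiff_normed (n := 1)) hu x
  have hd' : fderiv ℝ (mollify j u) x = _ := hd.fderiv
  have hint : Integrable (fun t => (ContinuousLinearMap.precompL (EuclideanSpace ℝ (Fin k))
      (ContinuousLinearMap.lsmul ℝ ℝ)) (fderiv ℝ (b.normed volume) t) (u (x - t))) volume :=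
    HasCompactSupport.convolutionExists_left _ (b.hasCompactSupport_normed.fderiv (𝕜 := ℝ))
      ((b.contDiff_normed (n := 1)).continuous_fderiv one_ne_zero) hu x
  have hd2 : fderiv ℝ (mollify j u) x (EuclideanSpace.single i 1) =
      convolution (fun t => fderiv ℝ (b.normed volume) t (EuclideanSpace.single i 1)) u
        (ContinuousLinearMap.lsmul ℝ ℝ) volume x := by
    rw [hd', convolution, ContinuousLinearMap.integral_apply hint]
    rfl
  rw [hd2]
  set φ : EuclideanSpace ℝ (Fin k) → ℝ := fun y => b.normed volume (x - y) with hφ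
  have hφs : ContDiff ℝ ∞ φ := b.contDiff_normed.comp (contDiff_const.sub contDiff_id)
  have hφc : HasCompactSupport φ :=
    (b.hasCompactSupport_normed (μ := volume)).comp_homeomorph (Homeomorph.subLeft x)
  have h1 := hw φ hφs hφc (subset_univ _)
  have h2 : ∀ y, fderiv ℝ φ y (EuclideanSpace.single i 1)
      = - fderiv ℝ (b.normed volume) (x - y) (EuclideanSpace.single i 1) := by
    intro y
    have hA : HasFDerivAt (b.normed volume) (fderiv ℝ (b.normed volume) (x - y)) (x - y) :=
      ((b.contDiff_normed (n := 1)).differentiable one_ne_zero _).hasFDerivAt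
    have hB : HasFDerivAt (fun y => x - y) (-(ContinuousLinearMap.id ℝ _)) y :=
      (hasFDerivAt_id y).const_sub x
    have hC : HasFDerivAt φ _ y := hA.comp y hB
    rw [hC.fderiv]
    simp
  simp only [setIntegral_univ, h2, mul_neg, integral_neg, neg_inj] at h1
  rw [mollify, convolution_eq_swap, convolution_eq_swap]
  simp only [ContinuousLinearMap.lsmul_apply, smul_eq_mul]
  calc _ = ∫ y, u y * fderiv ℝ (b.normed volume) (x - y) (EuclideanSpace.single i 1) := by
        congr 1; ext y; rw [mul_comm]
    _ = _ := h1
    _ = _ := by congr 1; ext y; rw [mul_comm]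

/-! ### Products in Lebesgue spaces -/

theorem memLp_mul_of_hasCompactSupport {X : Type*} [TopologicalSpace X] [MeasurableSpace X]
    [OpensMeasurableSpace X] {μ : Measure X} [IsFiniteMeasureOnCompacts μ]
    {χ u : X → ℝ} {p : ℝ≥0∞} (hχ : Continuous χ) (hc : HasCompactSupport χ) (hu : MemLp u p μ) :
    MemLp (fun x => χ x * u x) p μ :=
  hu.mul' (hχ.memLp_of_hasCompactSupport hc (p := ⊤))

theorem tendsto_integral_mul_of_tendsto_eLpNorm {α : Type*} [MeasurableSpace α] {μ : Measure α}
    {p q : ℝ≥0∞} [ENNReal.HolderConjugate p q] {a f : α → ℝ} {F : ℕ → α → ℝ}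
    (ha : MemLp a p μ) (hf : MemLp f q μ) (hF : ∀ j, AEStronglyMeasurable (F j) μ)
    (h : Tendsto (fun j => eLpNorm (F j - f) q μ) atTop (𝓝 0)) :
    Tendsto (fun j => ∫ x, a x * F j x ∂μ) atTop (𝓝 (∫ x, a x * f x ∂μ)) := by
  have hbound : ∀ j, eLpNorm (fun x => a x * (F j x - f x)) 1 μ
      ≤ eLpNorm a p μ * eLpNorm (F j - f) q μ := fun j => by
    have h1 := eLpNorm_smul_le_mul_eLpNorm (p := p) (q := q) (r := 1) ((hF j).sub hf.1) ha.1
    exact h1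
  have hlim : Tendsto (fun j => eLpNorm a p μ * eLpNorm (F j - f) q μ) atTop (𝓝 0) := by
    have := ENNReal.Tendsto.const_mul h (Or.inr ha.2.ne)
    simpa using this
  have hi : Integrable (fun x => a x * f x) μ := ha.integrable_mul hf
  refine tendsto_integral_of_L1' _ hi.1 ?_ ?_
  · have hev : ∀ᶠ j in atTop, eLpNorm (F j - f) q μ < 1 := h.eventually (gt_mem_nhds one_pos)
    filter_upwards [hev] with j hj
    have h1 : MemLp (F j - f) q μ := ⟨(hF j).sub hf.1, hj.trans ENNReal.one_lt_top⟩
    have h2 : Integrable (fun x => a x * (F j - f) x) μ := ha.integrable_mul h1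
    refine (h2.add hi).congr (.of_forall fun x => ?_)
    simp only [Pi.add_apply, Pi.sub_apply]; ring
  · refine tendsto_of_tendsto_of_tendsto_of_le_of_le tendsto_const_nhds hlim
      (fun _ => zero_le) fun j => ?_
    refine le_trans (le_of_eq (congrArg (fun g => eLpNorm g 1 μ) ?_)) (hbound j)
    funext x
    simp only [Pi.sub_apply]; ring

/-! ### Weak gradients, the Sobolev inequality and the product rule -/

/-- `u ∈ W^{1,p}(U)` with prescribed weak partial derivatives `g`. -/
structure HasWeakGradient (p : ℝ≥0∞) (U : Set (EuclideanSpace ℝ (Fin k)))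
    (u : EuclideanSpace ℝ (Fin k) → ℝ) (g : Fin k → EuclideanSpace ℝ (Fin k) → ℝ) : Prop where
  memLp : MemLp u p (volume.restrict U)
  hasWeakPartial : ∀ i, HasWeakPartial U i u (g i)
  memLp_partial : ∀ i, MemLp (g i) p (volume.restrict U)

theorem norm_le_sum_norm_apply_single (L : EuclideanSpace ℝ (Fin k) →L[ℝ] ℝ) :
    ‖L‖ ≤ ∑ i, ‖L (EuclideanSpace.single i 1)‖ := by
  refine L.opNorm_le_bound (Finset.sum_nonneg fun _ _ => norm_nonneg _) fun v => ?_
  have hv : v = ∑ i, v i • EuclideanSpace.single i (1 : ℝ) := by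
    ext j
    simp [Pi.single_apply]
  conv_lhs => rw [hv]
  rw [map_sum, Finset.sum_mul]
  refine (norm_sum_le _ _).trans (Finset.sum_le_sum fun i _ => ?_)
  rw [map_smul, norm_smul, mul_comm]
  gcongr
  exact PiLp.norm_apply_le v i

/-- The Gagliardo-Nirenberg-Sobolev inequality for compactly supported functions of `W^{1,p}`,
as an embedding into `L^q`: the mollifications are bounded in `L^q` and converge almost
everywhere, so that Fatou's lemma applies. -/
theorem HasWeakGradient.memLp_sobolev {p q : ℝ≥0} (hp : 1 ≤ p) (hk : 0 < k)
    (hpq : (q : ℝ)⁻¹ = (p : ℝ)⁻¹ - (k : ℝ)⁻¹) {u : EuclideanSpace ℝ (Fin k) → ℝ}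
    {g : Fin k → EuclideanSpace ℝ (Fin k) → ℝ} (h : HasWeakGradient p univ u g)
    (hc : HasCompactSupport u) : MemLp u q volume := by
  have hp' : (1 : ℝ≥0∞) ≤ p := by exact_mod_cast hp
  have hu := h.memLp
  have hg := h.memLp_partial
  rw [Measure.restrict_univ] at hu
  simp only [Measure.restrict_univ] at hg
  have hul := hu.locallyIntegrable hp'
  have hgl := fun i => (hg i).locallyIntegrable hp'
  set C₀ : ℝ≥0 := SNormLESNormFDerivOfEqConst ℝ
    (volume : Measure (EuclideanSpace ℝ (Fin k))) p
  set C : ℝ≥0∞ := ENNReal.ofNNReal C₀ with hC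
  have hbound : ∀ j, eLpNorm (mollify j u) q volume ≤
      C * ∑ i, eLpNorm (mollify j (g i)) p volume := by
    intro j
    have h1 := eLpNorm_le_eLpNorm_fderiv_of_eq (volume : Measure (EuclideanSpace ℝ (Fin k)))
      (F := ℝ) ((contDiff_mollify j hul).of_le (by norm_cast))
      (hasCompactSupport_mollify j hc) hp (by simpa using hk) (p' := q) (by simpa using hpq)
    refine h1.trans ?_
    gcongr
    have h2 : eLpNorm (fderiv ℝ (mollify j u)) p volume ≤
        eLpNorm (∑ i, fun x => ‖mollify j (g i) x‖) p volume := by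
      refine eLpNorm_mono_real fun x => ?_
      rw [Finset.sum_apply]
      refine (norm_le_sum_norm_apply_single _).trans (le_of_eq ?_)
      refine Finset.sum_congr rfl fun i _ => ?_
      rw [fderiv_mollify j (h.hasWeakPartial i)]
    refine h2.trans ((eLpNorm_sum_le (fun i _ => ?_) hp').trans (le_of_eq ?_))
    · exact ((contDiff_mollify j (hgl i)).continuous.norm).aestronglyMeasurable
    · exact Finset.sum_congr rfl fun i _ => eLpNorm_norm _
  have hev : ∀ᶠ j in atTop, eLpNorm (mollify j u) q volume ≤
      C * ∑ i, (1 + eLpNorm (g i) p volume) := by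
    have h1 : ∀ᶠ j in atTop, ∀ i, eLpNorm (mollify j (g i) - g i) p volume ≤ 1 :=
      eventually_all.2 fun i => (tendsto_eLpNorm_mollify_sub hp' (by simp) (hg i)).eventually
        (ge_mem_nhds one_pos)
    filter_upwards [h1] with j hj
    refine (hbound j).trans ?_
    gcongr with i _
    calc eLpNorm (mollify j (g i)) p volume
        = eLpNorm ((mollify j (g i) - g i) + g i) p volume := by rw [sub_add_cancel]
      _ ≤ _ := (eLpNorm_add_le
          ((contDiff_mollify j (hgl i)).continuous.aestronglyMeasurable.sub (hg i).1)
          (hg i).1 hp').trans (by gcongr; exact hj i)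
  have hae : ∀ᵐ x ∂(volume : Measure (EuclideanSpace ℝ (Fin k))),
      Tendsto (fun j => mollify j u x) atTop (𝓝 (u x)) :=
    ContDiffBump.ae_convolution_tendsto_right_of_locallyIntegrable (K := 2)
      (φ := mollifierBump (EuclideanSpace ℝ (Fin k)))
      tendsto_one_div_add_atTop_nhds_zero_nat
      (.of_forall fun j => le_of_eq (by simp only [mollifierBump]; field_simp)) hul
  refine ⟨hu.1, (Lp.eLpNorm_le_of_ae_tendsto hev
    (fun j => (contDiff_mollify j hul).continuous.aestronglyMeasurable) hae).trans_lt ?_⟩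
  refine ENNReal.mul_lt_top (by simp [hC]) (ENNReal.sum_lt_top.2 fun i _ => ?_)
  exact ENNReal.add_lt_top.2 ⟨ENNReal.one_lt_top, (hg i).2⟩

/-- The product rule for weak derivatives, integrated against a test function, for factors
in `W^{1,p}` and `L^q` with `1/p + 1/q = 1`. For smooth `v` it is the definition of the weak
derivative of `u`, tested with `χ v`; the general case follows by mollifying `v`. -/
theorem integral_mul_weakPartial_add {p q : ℝ≥0∞} [ENNReal.HolderConjugate p q]
    (hp : p ≠ ⊤) (hq : q ≠ ⊤)
    {i : Fin k} {u v g h : EuclideanSpace ℝ (Fin k) → ℝ}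
    (hug : HasWeakPartial univ i u g) (hvh : HasWeakPartial univ i v h)
    (hup : MemLp u p volume) (huq : MemLp u q volume) (hvq : MemLp v q volume)
    (hgp : MemLp g p volume) (hhp : MemLp h p volume)
    {χ : EuclideanSpace ℝ (Fin k) → ℝ} (hχ : ContDiff ℝ ∞ χ) (hχc : HasCompactSupport χ) :
    (∫ x, χ x * (u x * h x)) + (∫ x, χ x * (g x * v x)) +
      ∫ x, fderiv ℝ χ x (EuclideanSpace.single i 1) * (u x * v x) = 0 := by
  have hp1 : 1 ≤ p := ENNReal.HolderConjugate.one_le p q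
  have : ENNReal.HolderConjugate q p := ENNReal.HolderTriple.symm
  have hq1 : 1 ≤ q := ENNReal.HolderConjugate.one_le q p
  have hvl := hvq.locallyIntegrable hq1
  have hhl := hhp.locallyIntegrable hp1
  set e : EuclideanSpace ℝ (Fin k) := EuclideanSpace.single i 1
  have hχd : Continuous fun x => fderiv ℝ χ x e :=
    (hχ.continuous_fderiv (by simp)).clm_apply continuous_const
  have hχdc : HasCompactSupport fun x => fderiv ℝ χ x e := hχc.fderiv_apply (𝕜 := ℝ) e
  have huχ : MemLp (fun x => χ x * u x) q volume :=
    memLp_mul_of_hasCompactSupport hχ.continuous hχc huq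
  have hgχ : MemLp (fun x => χ x * g x) p volume :=
    memLp_mul_of_hasCompactSupport hχ.continuous hχc hgp
  have hudχ : MemLp (fun x => fderiv ℝ χ x e * u x) p volume :=
    memLp_mul_of_hasCompactSupport hχd hχdc hup
  have hmv : ∀ j, AEStronglyMeasurable (mollify j v) volume := fun j =>
    (contDiff_mollify j hvl).continuous.aestronglyMeasurable
  have hmh : ∀ j, AEStronglyMeasurable (mollify j h) volume := fun j =>
    (contDiff_mollify j hhl).continuous.aestronglyMeasurable
  have T1 := tendsto_integral_mul_of_tendsto_eLpNorm huχ hhp hmh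
    (tendsto_eLpNorm_mollify_sub hp1 hp hhp)
  have T2 := tendsto_integral_mul_of_tendsto_eLpNorm hgχ hvq hmv
    (tendsto_eLpNorm_mollify_sub hq1 hq hvq)
  have T3 := tendsto_integral_mul_of_tendsto_eLpNorm hudχ hvq hmv
    (tendsto_eLpNorm_mollify_sub hq1 hq hvq)
  have key : ∀ j, (∫ x, χ x * u x * mollify j h x) + (∫ x, χ x * g x * mollify j v x) +
      ∫ x, fderiv ℝ χ x e * u x * mollify j v x = 0 := by
    intro j
    have hvs := contDiff_mollify j hvl
    have h1 := hug.2.2 (fun x => χ x * mollify j v x) (hχ.mul hvs) hχc.mul_right (subset_univ _)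
    have h2 : ∀ x, fderiv ℝ (fun x => χ x * mollify j v x) x e =
        χ x * mollify j h x + mollify j v x * fderiv ℝ χ x e := by
      intro x
      rw [fderiv_fun_mul (hχ.differentiable (by simp) x) (hvs.differentiable (by simp) x)]
      simp only [add_apply, smul_apply, smul_eq_mul]
      rw [fderiv_mollify j hvh]
    simp only [setIntegral_univ] at h1
    have hul := hug.1
    rw [locallyIntegrableOn_univ] at hul
    have i1 : Integrable (fun x => χ x * u x * mollify j h x) volume := by
      have := hul.integrable_smul_left_of_hasCompactSupport (g := fun x => χ x * mollify j h x)
        (hχ.continuous.mul (contDiff_mollify j hhl).continuous) hχc.mul_right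
      refine this.congr (.of_forall fun x => ?_)
      simp only [smul_eq_mul]; ring
    have i3 : Integrable (fun x => fderiv ℝ χ x e * u x * mollify j v x) volume := by
      have := hul.integrable_smul_left_of_hasCompactSupport
        (g := fun x => fderiv ℝ χ x e * mollify j v x)
        (hχd.mul hvs.continuous) hχdc.mul_right
      refine this.congr (.of_forall fun x => ?_)
      simp only [smul_eq_mul]; ring
    have h3 : ∫ x, u x * fderiv ℝ (fun x => χ x * mollify j v x) x e =
        (∫ x, χ x * u x * mollify j h x) + ∫ x, fderiv ℝ χ x e * u x * mollify j v x := by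
      rw [← integral_add i1 i3]
      refine integral_congr_ae (.of_forall fun x => ?_)
      simp only [h2]; ring
    have h4 : ∫ x, g x * (χ x * mollify j v x) = ∫ x, χ x * g x * mollify j v x :=
      integral_congr_ae (.of_forall fun x => by dsimp only; ring)
    rw [h3, h4] at h1
    linarith
  have T := (T1.add T2).add T3
  simp only [key] at T
  have := tendsto_nhds_unique T tendsto_const_nhds
  simpa only [mul_assoc] using this

/-- The Leibniz rule for a weak derivative and a test function `χ`. The product, extended by zero,
has a weak derivative on the whole space. -/
theorem HasWeakPartial.mul_of_hasCompactSupport {U : Set (EuclideanSpace ℝ (Fin k))}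
    {i : Fin k} {u g χ : EuclideanSpace ℝ (Fin k) → ℝ}
    (h : HasWeakPartial U i u g) (hu : IntegrableOn u U) (hg : IntegrableOn g U)
    (hχ : ContDiff ℝ ∞ χ) (hχc : HasCompactSupport χ) (hχU : tsupport χ ⊆ U) :
    HasWeakPartial univ i (fun x => χ x * u x)
      (fun x => χ x * g x + fderiv ℝ χ x (EuclideanSpace.single i 1) * u x) := by
  set e : EuclideanSpace ℝ (Fin k) := EuclideanSpace.single i 1
  have hχd : Continuous fun x => fderiv ℝ χ x e :=
    (hχ.continuous_fderiv (by simp)).clm_apply continuous_const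
  have hχdc : HasCompactSupport fun x => fderiv ℝ χ x e := hχc.fderiv_apply (𝕜 := ℝ) e
  have z1 : ∀ x ∉ U, χ x = 0 := fun x hx => image_eq_zero_of_notMem_tsupport fun h => hx (hχU h)
  have z2 : ∀ x ∉ U, fderiv ℝ χ x e = 0 := fun x hx =>
    image_eq_zero_of_notMem_tsupport (f := fun x => fderiv ℝ χ x e)
      fun h => hx (hχU (tsupport_fderiv_apply_subset ℝ e h))
  have key : ∀ {ψ w : EuclideanSpace ℝ (Fin k) → ℝ}, Continuous ψ → HasCompactSupport ψ →
      IntegrableOn w U → IntegrableOn (fun x => ψ x * w x) U := by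
    intro ψ w hψ hψc hw
    exact memLp_one_iff_integrable.1
      (memLp_mul_of_hasCompactSupport hψ hψc (memLp_one_iff_integrable.2 hw))
  have ext : ∀ {w : EuclideanSpace ℝ (Fin k) → ℝ}, IntegrableOn w U → (∀ x ∉ U, w x = 0) →
      Integrable w volume := fun hw hz =>
    (integrableOn_iff_integrable_of_support_subset fun x hx => by
      by_contra hxU; exact hx (hz x hxU)).1 hw
  have I1 := key hχ.continuous hχc hu
  have I2 := key hχ.continuous hχc hg
  have I3 := key hχd hχdc hu
  refine ⟨?_, ?_, ?_⟩
  · exact (ext I1 fun x hx => by simp [z1 x hx]).locallyIntegrable.locallyIntegrableOn _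
  · exact (ext (I2.add I3) fun x hx => by
      simp [z1 x hx, z2 x hx]).locallyIntegrable.locallyIntegrableOn _
  · intro φ hφ hφc _
    simp only [setIntegral_univ]
    have h1 := h.2.2 (fun x => χ x * φ x) (hχ.mul hφ) hχc.mul_right
      ((tsupport_mul_subset_left).trans hχU)
    have hφd : Continuous fun x => fderiv ℝ φ x e :=
      (hφ.continuous_fderiv (by simp)).clm_apply continuous_const
    have h2 : ∀ x, fderiv ℝ (fun x => χ x * φ x) x e =
        χ x * fderiv ℝ φ x e + φ x * fderiv ℝ χ x e := by
      intro x
      rw [fderiv_fun_mul (hχ.differentiable (by simp) x) (hφ.differentiable (by simp) x)]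
      simp only [add_apply, smul_apply, smul_eq_mul]
    have J1 : IntegrableOn (fun x => χ x * fderiv ℝ φ x e * u x) U :=
      key (hχ.continuous.mul hφd) hχc.mul_right hu
    have J2 : IntegrableOn (fun x => φ x * fderiv ℝ χ x e * u x) U :=
      key (hφ.continuous.mul hχd) hφc.mul_right hu
    have J3 : IntegrableOn (fun x => χ x * φ x * g x) U :=
      key (hχ.continuous.mul hφ.continuous) hχc.mul_right hg
    have f1 : ∫ x in U, χ x * u x * fderiv ℝ φ x e = ∫ x, χ x * u x * fderiv ℝ φ x e :=
      setIntegral_eq_integral_of_forall_compl_eq_zero fun x hx => by simp [z1 x hx]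
    have f2 : ∫ x in U, (χ x * g x + fderiv ℝ χ x e * u x) * φ x =
        ∫ x, (χ x * g x + fderiv ℝ χ x e * u x) * φ x :=
      setIntegral_eq_integral_of_forall_compl_eq_zero fun x hx => by simp [z1 x hx, z2 x hx]
    rw [← f1, ← f2]
    have e1 : ∫ x in U, u x * fderiv ℝ (fun x => χ x * φ x) x e =
        (∫ x in U, χ x * fderiv ℝ φ x e * u x) + ∫ x in U, φ x * fderiv ℝ χ x e * u x := by
      rw [← integral_add J1 J2]
      exact integral_congr_ae (.of_forall fun x => by simp only [h2]; ring)
    have e2 : ∫ x in U, (χ x * g x + fderiv ℝ χ x e * u x) * φ x =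
        (∫ x in U, χ x * φ x * g x) + ∫ x in U, φ x * fderiv ℝ χ x e * u x := by
      rw [← integral_add J3 J2]
      exact integral_congr_ae (.of_forall fun x => by dsimp only; ring)
    have e3 : ∫ x in U, g x * (χ x * φ x) = ∫ x in U, χ x * φ x * g x :=
      integral_congr_ae (.of_forall fun x => by dsimp only; ring)
    have e4 : ∫ x in U, χ x * u x * fderiv ℝ φ x e = ∫ x in U, χ x * fderiv ℝ φ x e * u x :=
      integral_congr_ae (.of_forall fun x => by dsimp only; ring)
    rw [e1, e3] at h1
    rw [e2, e4]
    linarith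

/-- A smooth cutoff which is `1` on a closed subset of the open unit ball to first order -/
theorem exists_contDiff_cutoff {s : Set (EuclideanSpace ℝ (Fin k))} (hs : IsClosed s)
    (hsB : s ⊆ ball 0 1) :
    ∃ ψ : EuclideanSpace ℝ (Fin k) → ℝ, ContDiff ℝ ∞ ψ ∧ HasCompactSupport ψ ∧
      tsupport ψ ⊆ ball 0 1 ∧ (∀ x ∈ s, ψ x = 1) ∧ ∀ x ∈ s, fderiv ℝ ψ x = 0 := by
  obtain ⟨r, ⟨hr0, hr1⟩, hsr⟩ := exists_pos_lt_subset_ball one_pos hs hsB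
  let b : ContDiffBump (0 : EuclideanSpace ℝ (Fin k)) :=
    { rIn := r, rOut := (r + 1) / 2, rIn_pos := hr0, rIn_lt_rOut := by linarith }
  refine ⟨b, b.contDiff, b.hasCompactSupport, ?_, fun x hx => ?_, fun x hx => ?_⟩
  · rw [b.tsupport_eq]
    exact closedBall_subset_ball (by change (r + 1) / 2 < 1; linarith)
  · exact b.one_of_mem_closedBall (ball_subset_closedBall (hsr hx))
  · have : (b : EuclideanSpace ℝ (Fin k) → ℝ) =ᶠ[𝓝 x] fun _ => 1 := by
      filter_upwards [isOpen_ball.mem_nhds (hsr hx)] with y hy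
      exact b.one_of_mem_closedBall (ball_subset_closedBall hy)
    rw [this.fderiv_eq]
    simp

/-- A function of `W^{1,p}` on the ball, multiplied by a cutoff, belongs to `W^{1,p}(ℝ^k)`. -/
theorem HasWeakGradient.mul_of_hasCompactSupport {p : ℝ≥0∞} (hp : 1 ≤ p)
    {u χ : EuclideanSpace ℝ (Fin k) → ℝ} {g : Fin k → EuclideanSpace ℝ (Fin k) → ℝ}
    (h : HasWeakGradient p (ball 0 1) u g)
    (hχ : ContDiff ℝ ∞ χ) (hχc : HasCompactSupport χ) (hχU : tsupport χ ⊆ ball 0 1) :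
    HasWeakGradient p univ (fun x => χ x * u x)
      (fun i x => χ x * g i x + fderiv ℝ χ x (EuclideanSpace.single i 1) * u x) := by
  have z1 : ∀ x ∉ ball (0 : EuclideanSpace ℝ (Fin k)) 1, χ x = 0 :=
    fun x hx => image_eq_zero_of_notMem_tsupport fun h => hx (hχU h)
  have z2 : ∀ e, ∀ x ∉ ball (0 : EuclideanSpace ℝ (Fin k)) 1, fderiv ℝ χ x e = 0 := fun e x hx =>
    image_eq_zero_of_notMem_tsupport (f := fun x => fderiv ℝ χ x e)
      fun h => hx (hχU (tsupport_fderiv_apply_subset ℝ e h))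
  have ext : ∀ {w : EuclideanSpace ℝ (Fin k) → ℝ},
      MemLp w p (volume.restrict (ball 0 1)) → (∀ x ∉ ball 0 1, w x = 0) → MemLp w p volume := by
    intro w hw hz
    rw [← memLp_indicator_iff_restrict measurableSet_ball] at hw
    rwa [indicator_eq_self.2] at hw
    intro x hx
    by_contra hxU; exact hx (hz x hxU)
  have hfin : ∀ {w : EuclideanSpace ℝ (Fin k) → ℝ},
      MemLp w p (volume.restrict (ball 0 1)) → IntegrableOn w (ball 0 1) := fun hw => by
    have : IsFiniteMeasure ((volume : Measure (EuclideanSpace ℝ (Fin k))).restrict (ball 0 1)) :=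
      ⟨by simpa using measure_ball_lt_top⟩
    exact hw.integrable hp
  refine ⟨?_, fun i => ?_, fun i => ?_⟩
  · rw [Measure.restrict_univ]
    exact ext (memLp_mul_of_hasCompactSupport hχ.continuous hχc h.memLp)
      fun x hx => by simp [z1 x hx]
  · exact (h.hasWeakPartial i).mul_of_hasCompactSupport (hfin h.memLp) (hfin (h.memLp_partial i))
      hχ hχc hχU
  · rw [Measure.restrict_univ]
    have hχd : Continuous fun x => fderiv ℝ χ x (EuclideanSpace.single i (1 : ℝ)) :=
      (hχ.continuous_fderiv (by simp)).clm_apply continuous_const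
    refine ext ((memLp_mul_of_hasCompactSupport hχ.continuous hχc (h.memLp_partial i)).add
      (memLp_mul_of_hasCompactSupport hχd (hχc.fderiv_apply (𝕜 := ℝ) _) h.memLp))
      fun x hx => by simp [z1 x hx, z2 _ x hx]

/-- The exponents `p` and `q` are conjugate, and `q` is the Sobolev conjugate of `p` in
dimension `k`. -/
structure CriticalExponents (k : ℕ) (p q : ℝ≥0) : Prop where
  pos : 0 < k
  one_le : 1 ≤ p
  holder : ENNReal.HolderConjugate (p : ℝ≥0∞) q
  sobolev : (q : ℝ)⁻¹ = (p : ℝ)⁻¹ - (k : ℝ)⁻¹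

/-- The integral form of `∂_i (χ u v) = χ u ∂_i v + χ ∂_i u v + ∂_i χ u v` for `u`, `v` in
`W^{1,p}` of the unit ball and a test function `χ`, at the critical exponent. -/
theorem HasWeakGradient.integral_product_rule {p q : ℝ≥0} (hpq : CriticalExponents k p q)
    {u v χ : EuclideanSpace ℝ (Fin k) → ℝ} {g h : Fin k → EuclideanSpace ℝ (Fin k) → ℝ}
    (hu : HasWeakGradient p (ball 0 1) u g) (hv : HasWeakGradient p (ball 0 1) v h)
    (hχ : ContDiff ℝ ∞ χ) (hχc : HasCompactSupport χ) (hχU : tsupport χ ⊆ ball 0 1) (i : Fin k) :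
    Integrable (fun x => χ x * (u x * h i x)) volume ∧
    Integrable (fun x => χ x * (g i x * v x)) volume ∧
    Integrable (fun x => fderiv ℝ χ x (EuclideanSpace.single i 1) * (u x * v x)) volume ∧
    (∫ x, χ x * (u x * h i x)) + (∫ x, χ x * (g i x * v x)) +
      ∫ x, fderiv ℝ χ x (EuclideanSpace.single i 1) * (u x * v x) = 0 := by
  have := hpq.holder
  have : ENNReal.HolderConjugate (q : ℝ≥0∞) p := ENNReal.HolderTriple.symm
  have hp1 : (1 : ℝ≥0∞) ≤ p := by exact_mod_cast hpq.one_le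
  -- `ψ u` and `ψ v` are of class `W^{1,p}` on the whole space, and agree with `u` and `v` on the
  -- support of `χ`
  obtain ⟨ψ, hψ, hψc, hψU, hψ1, hψd⟩ := exists_contDiff_cutoff (isClosed_tsupport χ) hχU
  have hU := hu.mul_of_hasCompactSupport hp1 hψ hψc hψU
  have hV := hv.mul_of_hasCompactSupport hp1 hψ hψc hψU
  have hUq := hU.memLp_sobolev hpq.one_le hpq.pos hpq.sobolev hψc.mul_right
  have hVq := hV.memLp_sobolev hpq.one_le hpq.pos hpq.sobolev hψc.mul_right
  have hUp := hU.memLp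
  have hVp := hV.memLp
  have hGp := hU.memLp_partial i
  have hHp := hV.memLp_partial i
  rw [Measure.restrict_univ] at hUp hVp hGp hHp
  set e : EuclideanSpace ℝ (Fin k) := EuclideanSpace.single i 1
  have hχd : Continuous fun x => fderiv ℝ χ x e :=
    (hχ.continuous_fderiv (by simp)).clm_apply continuous_const
  have hχdc : HasCompactSupport fun x => fderiv ℝ χ x e := hχc.fderiv_apply (𝕜 := ℝ) e
  have z1 : ∀ x ∉ tsupport χ, χ x = 0 := fun x hx => image_eq_zero_of_notMem_tsupport hx
  have z2 : ∀ x ∉ tsupport χ, fderiv ℝ χ x e = 0 := fun x hx =>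
    image_eq_zero_of_notMem_tsupport (f := fun x => fderiv ℝ χ x e)
      fun h => hx (tsupport_fderiv_apply_subset ℝ e h)
  have main := integral_mul_weakPartial_add (by simp) (by simp) (hU.hasWeakPartial i)
    (hV.hasWeakPartial i) hUp hUq hVq hGp hHp hχ hχc
  have E1 : (fun x => χ x * (ψ x * u x * (ψ x * h i x + fderiv ℝ ψ x e * v x))) =
      fun x => χ x * (u x * h i x) := by
    funext x
    by_cases hx : x ∈ tsupport χ
    · simp [hψ1 x hx, hψd x hx]
    · simp [z1 x hx]
  have E2 : (fun x => χ x * ((ψ x * g i x + fderiv ℝ ψ x e * u x) * (ψ x * v x))) =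
      fun x => χ x * (g i x * v x) := by
    funext x
    by_cases hx : x ∈ tsupport χ
    · simp [hψ1 x hx, hψd x hx]
    · simp [z1 x hx]
  have E3 : (fun x => fderiv ℝ χ x e * (ψ x * u x * (ψ x * v x))) =
      fun x => fderiv ℝ χ x e * (u x * v x) := by
    funext x
    by_cases hx : x ∈ tsupport χ
    · simp [hψ1 x hx]
    · simp [z2 x hx]
  rw [E1, E2, E3] at main
  refine ⟨?_, ?_, ?_, main⟩
  · rw [← E1]
    exact memLp_one_iff_integrable.1 (memLp_mul_of_hasCompactSupport hχ.continuous hχc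
      (memLp_one_iff_integrable.2 (hUq.integrable_mul hHp)))
  · rw [← E2]
    exact memLp_one_iff_integrable.1 (memLp_mul_of_hasCompactSupport hχ.continuous hχc
      (memLp_one_iff_integrable.2 (hGp.integrable_mul hVq)))
  · rw [← E3]
    exact memLp_one_iff_integrable.1 (memLp_mul_of_hasCompactSupport hχd hχdc
      (memLp_one_iff_integrable.2 (hUp.integrable_mul hVq)))

/-! ### Wedge products as alternating sums -/

section Algebra

variable {V : Type*} {ι κ : Type*} [Fintype ι] [DecidableEq ι] [Fintype κ] [DecidableEq κ]

/-- The alternating sum `∑_σ sign σ • F (v ∘ σ)`, for an arbitrary function `F`. -/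
def altSum (F : (ι → V) → ℝ) (v : ι → V) : ℝ :=
  ∑ σ : Equiv.Perm ι, ((Equiv.Perm.sign σ : ℤ) : ℝ) * F (v ∘ σ)

theorem altSum_reindex (τ : ι ≃ κ) (F : (ι → V) → ℝ) (v : κ → V) :
    altSum (fun u : κ → V => F (u ∘ τ)) v = altSum F (v ∘ τ) := by
  unfold altSum
  refine (Fintype.sum_equiv τ.permCongr _ _ fun σ => ?_).symm
  rw [Equiv.Perm.sign_permCongr]
  congr 2
  ext i
  simp [Equiv.permCongr_apply]

theorem altSum_comp_perm (τ : Equiv.Perm ι) (F : (ι → V) → ℝ) (v : ι → V) :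
    altSum F (v ∘ τ) = ((Equiv.Perm.sign τ : ℤ) : ℝ) * altSum F v := by
  unfold altSum
  rw [Finset.mul_sum]
  refine Fintype.sum_equiv (Equiv.mulLeft τ) _ _ fun σ => ?_
  rw [Equiv.coe_mulLeft, Equiv.Perm.sign_mul, ← mul_assoc]
  have h : ((Equiv.Perm.sign τ : ℤ) : ℝ) * (((Equiv.Perm.sign τ * Equiv.Perm.sign σ : ℤˣ) : ℤ) : ℝ)
      = ((Equiv.Perm.sign σ : ℤ) : ℝ) := by
    rw [← Int.cast_mul, ← Units.val_mul, ← mul_assoc, Int.units_mul_self, one_mul]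
  rw [h]
  rfl

theorem altSum_const_mul (c : ℝ) (F : (ι → V) → ℝ) (v : ι → V) :
    altSum (fun u => c * F u) v = c * altSum F v := by
  simp only [altSum, Finset.mul_sum]
  exact Finset.sum_congr rfl fun σ _ => by ring

theorem altSum_sum {α : Type*} (s : Finset α) (F : α → (ι → V) → ℝ) (v : ι → V) :
    altSum (fun u => ∑ i ∈ s, F i u) v = ∑ i ∈ s, altSum (F i) v := by
  simp only [altSum, Finset.mul_sum]
  exact Finset.sum_comm

/-- Alternating over a block of variables first only multiplies the alternating sum over all
variables by the number of permutations of the block. -/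
theorem altSum_altSum_mul (F : (ι → V) → ℝ) (G : (κ → V) → ℝ) (v : ι ⊕ κ → V) :
    altSum (fun u : ι ⊕ κ → V => altSum F (u ∘ Sum.inl) * G (u ∘ Sum.inr)) v =
      (Fintype.card ι).factorial *
        altSum (fun u : ι ⊕ κ → V => F (u ∘ Sum.inl) * G (u ∘ Sum.inr)) v := by
  have h : ∀ τ : Equiv.Perm ι,
      altSum (fun u : ι ⊕ κ → V => F (u ∘ Sum.inl) * G (u ∘ Sum.inr)) v =
      ∑ σ : Equiv.Perm (ι ⊕ κ), ((Equiv.Perm.sign σ : ℤ) : ℝ) *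
        (((Equiv.Perm.sign τ : ℤ) : ℝ) * F ((v ∘ σ ∘ Sum.inl) ∘ τ) * G (v ∘ σ ∘ Sum.inr)) := by
    intro τ
    refine (Fintype.sum_equiv (Equiv.mulRight (Equiv.Perm.sumCongr τ 1)) _ _ fun σ => ?_).symm
    rw [Equiv.coe_mulRight, Equiv.Perm.sign_mul, Equiv.Perm.sign_sumCongr, Units.val_mul,
      Int.cast_mul, Equiv.Perm.sign_one, mul_one, mul_assoc, mul_assoc]
    rfl
  have h2 : ((Fintype.card ι).factorial : ℝ) *
        altSum (fun u : ι ⊕ κ → V => F (u ∘ Sum.inl) * G (u ∘ Sum.inr)) v =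
      ∑ _τ : Equiv.Perm ι, altSum (fun u : ι ⊕ κ → V => F (u ∘ Sum.inl) * G (u ∘ Sum.inr)) v := by
    rw [Finset.sum_const, Finset.card_univ, Fintype.card_perm, nsmul_eq_mul]
  rw [h2, Finset.sum_congr rfl fun τ _ => h τ, Finset.sum_comm]
  unfold altSum
  refine Finset.sum_congr rfl fun σ _ => ?_
  rw [← Finset.mul_sum]
  dsimp only
  rw [Finset.sum_mul]
  rfl

theorem altSum_mul_altSum (F : (ι → V) → ℝ) (G : (κ → V) → ℝ) (v : ι ⊕ κ → V) :
    altSum (fun u : ι ⊕ κ → V => F (u ∘ Sum.inl) * altSum G (u ∘ Sum.inr)) v =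
      (Fintype.card κ).factorial *
        altSum (fun u : ι ⊕ κ → V => F (u ∘ Sum.inl) * G (u ∘ Sum.inr)) v := by
  have h := altSum_altSum_mul G F (v ∘ Equiv.sumComm κ ι)
  rw [← altSum_reindex (Equiv.sumComm κ ι), ← altSum_reindex (Equiv.sumComm κ ι)] at h
  convert h using 2
  · ext u; rw [mul_comm]; rfl
  · congr 1; ext u; rw [mul_comm]; rfl

variable [AddCommGroup V] [Module ℝ V]

theorem alternatingMap_sum_apply {α ι' : Type*} (s : Finset α) (f : α → V [⋀^ι']→ₗ[ℝ] ℝ)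
    (v : ι' → V) : (∑ i ∈ s, f i) v = ∑ i ∈ s, f i v :=
  map_sum (⟨⟨fun w : V [⋀^ι']→ₗ[ℝ] ℝ => w v, rfl⟩, fun _ _ => rfl⟩ : _ →+ ℝ) f s

theorem altSum_alternatingMap (w : V [⋀^ι]→ₗ[ℝ] ℝ) (v : ι → V) :
    altSum w v = (Fintype.card ι).factorial * w v := by
  unfold altSum
  have : ∀ σ : Equiv.Perm ι, ((Equiv.Perm.sign σ : ℤ) : ℝ) * w (v ∘ σ) = w v := by
    intro σ
    rw [w.map_perm, Units.smul_def, zsmul_eq_mul, ← mul_assoc, ← Int.cast_mul, ← Units.val_mul,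
      Int.units_mul_self]
    simp
  simp only [this, Finset.sum_const, Finset.card_univ, Fintype.card_perm, nsmul_eq_mul]

/-- The alternatization of `D` as an alternating sum over all permutations. -/
theorem altSum_uncurry {a : ℕ} (D : V →ₗ[ℝ] V [⋀^Fin a]→ₗ[ℝ] ℝ) (v : Fin (a + 1) → V) :
    altSum (fun u : Fin (a + 1) → V => D (u 0) (u ∘ Fin.succ)) v =
      a.factorial * AlternatingMap.alternatizeUncurryFin D v := by
  have h1 := altSum_alternatingMap (AlternatingMap.alternatizeUncurryFin D) v
  have h2 : (⇑(AlternatingMap.alternatizeUncurryFin D) : (Fin (a + 1) → V) → ℝ) =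
      fun u => ∑ i : Fin (a + 1), (((-1 : ℤˣ) ^ (i : ℕ) : ℤˣ) : ℤ) *
        D ((u ∘ i.cycleRange.symm) 0) ((u ∘ i.cycleRange.symm) ∘ Fin.succ) := by
    ext u
    rw [AlternatingMap.alternatizeUncurryFin_apply]
    refine Finset.sum_congr rfl fun i _ => ?_
    rw [zsmul_eq_mul]
    congr 1
    simp only [Function.comp_apply, Fin.cycleRange_symm_zero]
    congr 1
    ext j
    simp [Fin.removeNth]
  rw [h2, altSum_sum] at h1
  have h3 : ∀ i : Fin (a + 1), altSum (fun u : Fin (a + 1) → V =>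
      ((((-1 : ℤˣ) ^ (i : ℕ) : ℤˣ) : ℤ) : ℝ) *
        D ((u ∘ i.cycleRange.symm) 0) ((u ∘ i.cycleRange.symm) ∘ Fin.succ)) v =
      altSum (fun u : Fin (a + 1) → V => D (u 0) (u ∘ Fin.succ)) v := by
    intro i
    rw [altSum_const_mul, altSum_reindex i.cycleRange.symm
      (fun u : Fin (a + 1) → V => D (u 0) (u ∘ Fin.succ)), altSum_comp_perm,
      Equiv.Perm.sign_symm, Fin.sign_cycleRange, ← mul_assoc, ← Int.cast_mul, ← Units.val_mul,
      Int.units_mul_self]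
    simp
  rw [Finset.sum_congr rfl fun i _ => h3 i, ← h2, Finset.sum_const, Finset.card_univ,
    Fintype.card_fin, Nat.factorial_succ, nsmul_eq_mul] at h1
  have h4 : ((a + 1 : ℕ) : ℝ) ≠ 0 := by positivity
  apply mul_left_cancel₀ h4
  rw [h1]
  push_cast
  ring

/-- The wedge product of alternating maps; `wedge` is its pointwise application. -/
def wedgeAt {a b c : ℕ} (h : a + b = c) (w : V [⋀^Fin a]→ₗ[ℝ] ℝ) (ζ : V [⋀^Fin b]→ₗ[ℝ] ℝ) :
    V [⋀^Fin c]→ₗ[ℝ] ℝ :=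
  ((LinearMap.mul' ℝ ℝ).compAlternatingMap (w.domCoprod ζ)).domDomCongr
    (finSumFinEquiv.trans (finCongr h))

/-- The wedge product as a sum over all permutations in place of shuffles. -/
theorem wedgeAt_apply {a b c : ℕ} (h : a + b = c) (w : V [⋀^Fin a]→ₗ[ℝ] ℝ)
    (ζ : V [⋀^Fin b]→ₗ[ℝ] ℝ) (v : Fin c → V) :
    wedgeAt h w ζ v = ((a.factorial : ℝ) * b.factorial)⁻¹ *
      altSum (fun u : Fin a ⊕ Fin b → V => w (u ∘ Sum.inl) * ζ (u ∘ Sum.inr))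
        (v ∘ finSumFinEquiv.trans (finCongr h)) := by
  have h1 := congrArg (fun m => LinearMap.mul' ℝ ℝ (m (v ∘ finSumFinEquiv.trans (finCongr h))))
    (MultilinearMap.domCoprod_alternization_eq w ζ)
  simp only [Fintype.card_fin] at h1
  rw [AlternatingMap.smul_apply, map_nsmul, MultilinearMap.alternatization_apply, map_sum] at h1
  have h2 : wedgeAt h w ζ v =
      LinearMap.mul' ℝ ℝ (w.domCoprod ζ (v ∘ finSumFinEquiv.trans (finCongr h))) := rfl
  rw [h2, eq_inv_mul_iff_mul_eq₀ (by positivity), ← Nat.cast_mul, ← nsmul_eq_mul, ← h1]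
  refine Finset.sum_congr rfl fun σ _ => ?_
  rw [Units.smul_def, map_zsmul, zsmul_eq_mul]
  rfl

theorem wedgeAt_compLinearMap {W : Type*} [AddCommGroup W] [Module ℝ W] {a b c : ℕ}
    (h : a + b = c) (w : V [⋀^Fin a]→ₗ[ℝ] ℝ) (ζ : V [⋀^Fin b]→ₗ[ℝ] ℝ) (L : W →ₗ[ℝ] V) :
    (wedgeAt h w ζ).compLinearMap L = wedgeAt h (w.compLinearMap L) (ζ.compLinearMap L) := by
  ext v
  rw [AlternatingMap.compLinearMap_apply, wedgeAt_apply, wedgeAt_apply]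
  rfl

theorem wedgeAt_add_left {a b c : ℕ} (h : a + b = c) (w w' : V [⋀^Fin a]→ₗ[ℝ] ℝ)
    (ζ : V [⋀^Fin b]→ₗ[ℝ] ℝ) : wedgeAt h (w + w') ζ = wedgeAt h w ζ + wedgeAt h w' ζ := by
  ext v
  simp only [AlternatingMap.add_apply, wedgeAt_apply, ← mul_add, add_mul]
  simp only [altSum, ← Finset.sum_add_distrib, ← mul_add]

theorem wedgeAt_smul_left {a b c : ℕ} (h : a + b = c) (r : ℝ) (w : V [⋀^Fin a]→ₗ[ℝ] ℝ)
    (ζ : V [⋀^Fin b]→ₗ[ℝ] ℝ) : wedgeAt h (r • w) ζ = r • wedgeAt h w ζ := by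
  ext v
  simp only [AlternatingMap.smul_apply, wedgeAt_apply, smul_eq_mul, mul_assoc, altSum_const_mul]
  ring

/-- Wedge multiplication on the right by a fixed form, as a linear map. -/
def wedgeRight {a b c : ℕ} (h : a + b = c) (ζ : V [⋀^Fin b]→ₗ[ℝ] ℝ) :
    (V [⋀^Fin a]→ₗ[ℝ] ℝ) →ₗ[ℝ] V [⋀^Fin c]→ₗ[ℝ] ℝ where
  toFun w := wedgeAt h w ζ
  map_add' w w' := wedgeAt_add_left h w w' ζ
  map_smul' r w := wedgeAt_smul_left h r w ζ

/-- A linear functional as an alternating map in one variable. -/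
def oneForm (θ : V →ₗ[ℝ] ℝ) : V [⋀^Fin 1]→ₗ[ℝ] ℝ := AlternatingMap.ofSubsingleton ℝ V ℝ 0 θ

theorem oneForm_apply (θ : V →ₗ[ℝ] ℝ) (v : Fin 1 → V) : oneForm θ v = θ (v 0) := rfl

/-- The triple wedge product as one alternating sum over all permutations. -/
theorem wedgeAt_oneForm_wedgeAt {a b c d : ℕ} (h : a + b = c) (h' : 1 + c = d)
    (θ : V →ₗ[ℝ] ℝ) (α : V [⋀^Fin a]→ₗ[ℝ] ℝ) (β : V [⋀^Fin b]→ₗ[ℝ] ℝ) (v : Fin d → V) :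
    wedgeAt h' (oneForm θ) (wedgeAt h α β) v = ((a.factorial : ℝ) * b.factorial)⁻¹ *
      altSum (fun u : Fin 1 ⊕ (Fin a ⊕ Fin b) → V => θ (u (Sum.inl 0)) *
        (α (u ∘ Sum.inr ∘ Sum.inl) * β (u ∘ Sum.inr ∘ Sum.inr)))
      (v ∘ ((Equiv.sumCongr (Equiv.refl (Fin 1)) (finSumFinEquiv.trans (finCongr h))).trans
        (finSumFinEquiv.trans (finCongr h')))) := by
  rw [wedgeAt_apply]
  simp only [wedgeAt_apply]
  set e := finSumFinEquiv.trans (finCongr h)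
  set G : (Fin a ⊕ Fin b → V) → ℝ := fun u => α (u ∘ Sum.inl) * β (u ∘ Sum.inr)
  have h1 := altSum_mul_altSum (fun u : Fin 1 → V => θ (u 0)) G
    (v ∘ ((Equiv.sumCongr (Equiv.refl (Fin 1)) e).trans (finSumFinEquiv.trans (finCongr h'))))
  rw [Equiv.coe_trans, ← Function.comp_assoc, ← altSum_reindex, Fintype.card_sum,
    Fintype.card_fin, Fintype.card_fin, h] at h1
  have h2 : (fun u : Fin 1 ⊕ Fin c → V => oneForm θ (u ∘ Sum.inl) *
        (((a.factorial : ℝ) * b.factorial)⁻¹ * altSum G ((u ∘ Sum.inr) ∘ e))) =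
      fun u => ((a.factorial : ℝ) * b.factorial)⁻¹ *
        (fun u : Fin 1 ⊕ Fin c → V => θ (u (Sum.inl 0)) * altSum G ((u ∘ Sum.inr) ∘ e)) u := by
    ext u
    simp only [oneForm_apply, Function.comp_apply]
    ring
  rw [h2, altSum_const_mul]
  have hc : (c.factorial : ℝ) ≠ 0 := by positivity
  rw [Nat.factorial_one, Nat.cast_one, one_mul]
  have h3 : altSum (fun u : Fin 1 ⊕ Fin c → V => θ (u (Sum.inl 0)) *
      altSum G ((u ∘ Sum.inr) ∘ e)) (v ∘ (finSumFinEquiv.trans (finCongr h'))) = _ := h1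
  rw [h3, ← mul_assoc, ← mul_assoc, mul_comm ((c.factorial : ℝ)⁻¹), mul_assoc _ _ (c.factorial : ℝ),
    inv_mul_cancel₀ hc, mul_one]
  rfl

/-- `∑_i dx_i ∧ ∂_i η ∧ β = 0` if `dη = 0`. Here `D v` is the derivative of `η` in the direction
`v`, so that `dη` is the alternatization of `D`. -/
theorem sum_wedgeAt_eq_zero {a b c d : ℕ} (h : a + b = c) (h' : 1 + c = d)
    (e : Module.Basis (Fin k) ℝ V) (D : V →ₗ[ℝ] V [⋀^Fin a]→ₗ[ℝ] ℝ)
    (hD : AlternatingMap.alternatizeUncurryFin D = 0) (β : V [⋀^Fin b]→ₗ[ℝ] ℝ) (v : Fin d → V) :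
    ∑ i, wedgeAt h' (oneForm (e.coord i)) (wedgeAt h (D (e i)) β) v = 0 := by
  simp only [wedgeAt_oneForm_wedgeAt]
  rw [← Finset.mul_sum, ← altSum_sum]
  set E := (Equiv.sumCongr (Equiv.refl (Fin 1)) (finSumFinEquiv.trans (finCongr h))).trans
        (finSumFinEquiv.trans (finCongr h'))
  have h1 : (fun u : Fin 1 ⊕ (Fin a ⊕ Fin b) → V => ∑ i, e.coord i (u (Sum.inl 0)) *
        (D (e i) (u ∘ Sum.inr ∘ Sum.inl) * β (u ∘ Sum.inr ∘ Sum.inr))) =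
      fun u => D (u (Sum.inl 0)) (u ∘ Sum.inr ∘ Sum.inl) * β (u ∘ Sum.inr ∘ Sum.inr) := by
    ext u
    conv_rhs => rw [← e.sum_repr (u (Sum.inl 0))]
    rw [map_sum, alternatingMap_sum_apply, Finset.sum_mul]
    refine Finset.sum_congr rfl fun i _ => ?_
    rw [map_smul, AlternatingMap.smul_apply, smul_eq_mul, mul_assoc]
    rfl
  rw [h1]
  let s : Fin (a + 1) ≃ Fin 1 ⊕ Fin a :=
    (finSumFinEquiv.trans (finCongr (add_comm 1 a))).symm
  have hs0 : s 0 = Sum.inl 0 := by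
    rw [Equiv.symm_apply_eq]; rfl
  have hss : ∀ i : Fin a, s i.succ = Sum.inr i := by
    intro i
    rw [Equiv.symm_apply_eq]
    ext
    simp
  have h2 : ∀ u : Fin 1 ⊕ Fin a → V,
      altSum (fun u : Fin 1 ⊕ Fin a → V => D (u (Sum.inl 0)) (u ∘ Sum.inr)) u = 0 := by
    intro u
    have h3 := altSum_uncurry D (u ∘ s)
    rw [hD, ← altSum_reindex s] at h3
    simp only [Function.comp_apply, hs0, AlternatingMap.zero_apply, mul_zero] at h3
    rw [← h3]
    congr 1
    ext u
    congr 1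
    ext i
    simp [hss]
  have h4 := altSum_altSum_mul (fun u : Fin 1 ⊕ Fin a → V => D (u (Sum.inl 0)) (u ∘ Sum.inr))
    (fun u : Fin b → V => β u) ((v ∘ E) ∘ Equiv.sumAssoc (Fin 1) (Fin a) (Fin b))
  simp only [h2, zero_mul] at h4
  rw [← altSum_reindex] at h4
  have h5 : ((Fintype.card (Fin 1 ⊕ Fin a)).factorial : ℝ) ≠ 0 := by positivity
  have h6 := (mul_eq_zero.1 (h4.symm.trans (by simp [altSum]))).resolve_left h5
  rw [← altSum_reindex] at h6
  have h7 : altSum (fun u : Fin 1 ⊕ (Fin a ⊕ Fin b) → V =>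
      D (u (Sum.inl 0)) (u ∘ Sum.inr ∘ Sum.inl) * β (u ∘ Sum.inr ∘ Sum.inr)) (v ∘ E) = 0 := h6
  rw [h7, mul_zero]

/-- `∑_i dx_i ∧ η ∧ ∂_i ξ = ε (η ∧ dξ)`, where `D v` is the derivative of `ξ` in the direction `v`.
The number `ε` is a sign that depends only on the degrees; only `ε ≠ 0` is recorded. -/
theorem exists_sum_wedgeAt_eq {a b c d : ℕ} (h : a + b = c) (h' : 1 + c = d)
    (h'' : a + (b + 1) = d) :
    ∃ ε : ℝ, ε ≠ 0 ∧ ∀ {V : Type} [AddCommGroup V] [Module ℝ V]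
      (e : Module.Basis (Fin k) ℝ V) (η : V [⋀^Fin a]→ₗ[ℝ] ℝ)
      (D : V →ₗ[ℝ] V [⋀^Fin b]→ₗ[ℝ] ℝ) (v : Fin d → V),
      ∑ i, wedgeAt h' (oneForm (e.coord i)) (wedgeAt h η (D (e i))) v =
        ε * wedgeAt h'' η (AlternatingMap.alternatizeUncurryFin D) v := by
  set E := (Equiv.sumCongr (Equiv.refl (Fin 1)) (finSumFinEquiv.trans (finCongr h))).trans
        (finSumFinEquiv.trans (finCongr h')) with hE
  let s : Fin (b + 1) ≃ Fin 1 ⊕ Fin b :=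
    (finSumFinEquiv.trans (finCongr (add_comm 1 b))).symm
  have hs0 : s 0 = Sum.inl 0 := by
    rw [Equiv.symm_apply_eq]; rfl
  have hss : ∀ i : Fin b, s i.succ = Sum.inr i := by
    intro i
    rw [Equiv.symm_apply_eq]
    ext
    simp
  -- the rearrangement `(η, x, ξ) ↦ (x, η, ξ)` of the blocks of variables
  let t : Fin a ⊕ Fin (b + 1) ≃ Fin 1 ⊕ (Fin a ⊕ Fin b) :=
    ((Equiv.refl (Fin a)).sumCongr s).trans
      ((Equiv.sumAssoc (Fin a) (Fin 1) (Fin b)).symm.trans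
        (((Equiv.sumComm (Fin a) (Fin 1)).sumCongr (Equiv.refl (Fin b))).trans
          (Equiv.sumAssoc (Fin 1) (Fin a) (Fin b))))
  let f : Fin a ⊕ Fin (b + 1) ≃ Fin d := finSumFinEquiv.trans (finCongr h'')
  refine ⟨((Equiv.Perm.sign (t.trans (E.trans f.symm)) : ℤ) : ℝ), ?_, ?_⟩
  · exact_mod_cast (Units.ne_zero _)
  intro V _ _ e η D v
  simp only [wedgeAt_oneForm_wedgeAt]
  rw [← Finset.mul_sum, ← altSum_sum]
  have h1 : (fun u : Fin 1 ⊕ (Fin a ⊕ Fin b) → V => ∑ i, e.coord i (u (Sum.inl 0)) *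
        (η (u ∘ Sum.inr ∘ Sum.inl) * D (e i) (u ∘ Sum.inr ∘ Sum.inr))) =
      fun u => η (u ∘ Sum.inr ∘ Sum.inl) * D (u (Sum.inl 0)) (u ∘ Sum.inr ∘ Sum.inr) := by
    ext u
    conv_rhs => rw [← e.sum_repr (u (Sum.inl 0))]
    rw [map_sum, alternatingMap_sum_apply, Finset.mul_sum]
    refine Finset.sum_congr rfl fun i _ => ?_
    rw [map_smul, AlternatingMap.smul_apply, smul_eq_mul, mul_left_comm]
    rfl
  rw [h1, wedgeAt_apply]
  have h2 : ∀ u : Fin (b + 1) → V, AlternatingMap.alternatizeUncurryFin D u =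
      (b.factorial : ℝ)⁻¹ *
        altSum (fun u : Fin (b + 1) → V => D (u 0) (u ∘ Fin.succ)) u := by
    intro u
    rw [altSum_uncurry, ← mul_assoc, inv_mul_cancel₀ (by positivity), one_mul]
  simp only [h2, mul_left_comm _ ((b.factorial : ℝ)⁻¹) _]
  rw [altSum_const_mul, altSum_mul_altSum (fun u => η u)
    (fun u : Fin (b + 1) → V => D (u 0) (u ∘ Fin.succ)), Fintype.card_fin]
  have h3 : altSum (fun u : Fin 1 ⊕ (Fin a ⊕ Fin b) → V =>
        η (u ∘ Sum.inr ∘ Sum.inl) * D (u (Sum.inl 0)) (u ∘ Sum.inr ∘ Sum.inr)) (v ∘ E) =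
      altSum (fun u : Fin a ⊕ Fin (b + 1) → V =>
        η (u ∘ Sum.inl) * D ((u ∘ Sum.inr) 0) ((u ∘ Sum.inr) ∘ Fin.succ)) ((v ∘ E) ∘ t) := by
    rw [← altSum_reindex t]
    congr 1
    ext u
    have e1 : (u ∘ t) ∘ Sum.inl = u ∘ Sum.inr ∘ Sum.inl := rfl
    have e2 : ((u ∘ t) ∘ Sum.inr) 0 = u (Sum.inl 0) := by
      simp [t, hs0]
    have e3 : ((u ∘ t) ∘ Sum.inr) ∘ Fin.succ = u ∘ Sum.inr ∘ Sum.inr := by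
      ext i
      simp [t, hss]
    rw [e1, e2, e3]
  have h4 : (v ∘ E) ∘ t = (v ∘ f) ∘ (t.trans (E.trans f.symm)) := by
    ext i
    simp
  rw [h3, h4, altSum_comp_perm]
  have hb : ((b + 1).factorial : ℝ) ≠ 0 := by positivity
  have hb' : (b.factorial : ℝ) ≠ 0 := by positivity
  have ha' : (a.factorial : ℝ) ≠ 0 := by positivity
  field_simp
  rfl

end Algebra

/-! ### Weak partial derivatives -/

theorem integrableOn_mul_of_hasCompactSupport {U : Set (EuclideanSpace ℝ (Fin k))}
    {u ψ : EuclideanSpace ℝ (Fin k) → ℝ} (hu : LocallyIntegrableOn u U)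
    (hψ : Continuous ψ) (hψc : HasCompactSupport ψ) (hψU : tsupport ψ ⊆ U) :
    IntegrableOn (fun y => u y * ψ y) U := by
  have h1 : IntegrableOn u (tsupport ψ) := (hu.mono_set hψU).integrableOn_isCompact hψc
  have h2 : IntegrableOn (fun y => u y * ψ y) (tsupport ψ) := by
    refine (memLp_one_iff_integrable.1 (memLp_mul_of_hasCompactSupport hψ hψc
      (memLp_one_iff_integrable.2 h1))).congr (.of_forall fun y => mul_comm _ _)
  refine ((integrableOn_iff_integrable_of_support_subset fun y hy => ?_).1 h2).integrableOn
  by_contra hn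
  exact hy (by simp [image_eq_zero_of_notMem_tsupport hn])

theorem HasWeakPartial.add {U : Set (EuclideanSpace ℝ (Fin k))} {i : Fin k}
    {u v g h : EuclideanSpace ℝ (Fin k) → ℝ} (hu : HasWeakPartial U i u g)
    (hv : HasWeakPartial U i v h) :
    HasWeakPartial U i (fun y => u y + v y) (fun y => g y + h y) := by
  refine ⟨hu.1.add hv.1, hu.2.1.add hv.2.1, fun φ hφ hφc hφU => ?_⟩
  have hd : Continuous fun x => fderiv ℝ φ x (EuclideanSpace.single i (1 : ℝ)) :=
    (hφ.continuous_fderiv (by simp)).clm_apply continuous_const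
  have hdc := hφc.fderiv_apply (𝕜 := ℝ) (EuclideanSpace.single i (1 : ℝ))
  have hdU := (tsupport_fderiv_apply_subset ℝ (f := φ) (EuclideanSpace.single i (1 : ℝ))).trans hφU
  simp only [add_mul]
  rw [integral_add (integrableOn_mul_of_hasCompactSupport hu.1 hd hdc hdU)
      (integrableOn_mul_of_hasCompactSupport hv.1 hd hdc hdU),
    integral_add (integrableOn_mul_of_hasCompactSupport hu.2.1 hφ.continuous hφc hφU)
      (integrableOn_mul_of_hasCompactSupport hv.2.1 hφ.continuous hφc hφU), hu.2.2 φ hφ hφc hφU,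
      hv.2.2 φ hφ hφc hφU, neg_add]

theorem HasWeakPartial.const_mul {U : Set (EuclideanSpace ℝ (Fin k))} {i : Fin k}
    {u g : EuclideanSpace ℝ (Fin k) → ℝ} (hu : HasWeakPartial U i u g) (c : ℝ) :
    HasWeakPartial U i (fun y => c * u y) (fun y => c * g y) := by
  refine ⟨hu.1.smul c, hu.2.1.smul c, fun φ hφ hφc hφU => ?_⟩
  simp only [mul_assoc]
  rw [integral_const_mul, integral_const_mul, hu.2.2 φ hφ hφc hφU, mul_neg]

theorem HasWeakPartial.zero (U : Set (EuclideanSpace ℝ (Fin k))) (i : Fin k) :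
    HasWeakPartial U i (fun _ => 0) (fun _ => 0) :=
  ⟨locallyIntegrableOn_zero, locallyIntegrableOn_zero, fun φ _ _ _ => by simp⟩

/-- Weak partial derivatives are unique almost everywhere. -/
theorem HasWeakPartial.ae_eq {U : Set (EuclideanSpace ℝ (Fin k))} (hU : IsOpen U) {i : Fin k}
    {u g h : EuclideanSpace ℝ (Fin k) → ℝ} (hg : HasWeakPartial U i u g)
    (hh : HasWeakPartial U i u h) : ∀ᵐ y ∂(volume.restrict U), g y = h y := by
  have key := hU.ae_eq_zero_of_integral_contDiff_smul_eq_zero (μ := volume)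
    (hg.2.1.sub hh.2.1) fun φ hφ hφc hφU => by
      have h1 := (hg.2.2 φ hφ hφc hφU).symm.trans (hh.2.2 φ hφ hφc hφU)
      rw [neg_inj] at h1
      rw [← setIntegral_eq_integral_of_forall_compl_eq_zero (s := U) fun x hx => by
        simp [image_eq_zero_of_notMem_tsupport fun hn => hx (hφU hn)]]
      have h2 : ∀ y, φ y • (g - h) y = g y * φ y - h y * φ y := fun y => by
        simp only [Pi.sub_apply, smul_eq_mul]; ring
      simp only [h2]
      rw [integral_sub (integrableOn_mul_of_hasCompactSupport hg.2.1 hφ.continuous hφc hφU)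
        (integrableOn_mul_of_hasCompactSupport hh.2.1 hφ.continuous hφc hφU), h1, sub_self]
  rw [ae_restrict_iff' hU.measurableSet]
  filter_upwards [key] with y hy hyU
  exact sub_eq_zero.1 (hy hyU)

theorem HasWeakGradient.sum_const_mul {α : Type*} (s : Finset α) {p : ℝ≥0∞}
    {U : Set (EuclideanSpace ℝ (Fin k))} {u : α → EuclideanSpace ℝ (Fin k) → ℝ}
    {g : α → Fin k → EuclideanSpace ℝ (Fin k) → ℝ}
    (h : ∀ j ∈ s, HasWeakGradient p U (u j) (g j)) (c : α → ℝ) :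
    HasWeakGradient p U (fun y => ∑ j ∈ s, c j * u j y) (fun i y => ∑ j ∈ s, c j * g j i y) := by
  classical
  induction s using Finset.induction_on with
  | empty =>
    simp only [Finset.sum_empty]
    exact ⟨MemLp.zero', fun i => HasWeakPartial.zero U i, fun i => MemLp.zero'⟩
  | insert j s hj ih =>
    have h1 := h j (Finset.mem_insert_self j s)
    have h2 := ih fun l hl => h l (Finset.mem_insert_of_mem hl)
    simp only [Finset.sum_insert hj]
    exact ⟨(h1.memLp.const_mul _).add h2.memLp,
      fun i => ((h1.hasWeakPartial i).const_mul _).add (h2.hasWeakPartial i),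
      fun i => ((h1.memLp_partial i).const_mul _).add (h2.memLp_partial i)⟩

/-! ### Sobolev forms on the ball and Stokes' theorem -/

/-- The tuple of standard basis vectors with indices `I`. -/
noncomputable def stdTuple {a : ℕ} (I : Fin a → Fin k) (j : Fin a) : EuclideanSpace ℝ (Fin k) :=
  EuclideanSpace.single (I j) (1 : ℝ)

/-- An alternating map is determined by its values on increasing tuples of basis vectors. -/
theorem alternatingMap_ext_orderEmbedding {a : ℕ}
    {f g : EuclideanSpace ℝ (Fin k) [⋀^Fin a]→ₗ[ℝ] ℝ}
    (h : ∀ J : Fin a ↪o Fin k, f (stdTuple J) = g (stdTuple J)) : f = g := by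
  refine Module.Basis.ext_alternating (EuclideanSpace.basisFun (Fin k) ℝ).toBasis fun v hv => ?_
  have hb : (fun i => (EuclideanSpace.basisFun (Fin k) ℝ).toBasis (v i)) = stdTuple v := by
    ext i : 1
    simp [stdTuple]
  rw [hb]
  have hmono : StrictMono (v ∘ Tuple.sort v) :=
    (Tuple.monotone_sort v).strictMono_of_injective (hv.comp (Tuple.sort v).injective)
  have h1 := h (OrderEmbedding.ofStrictMono _ hmono)
  have h2 : stdTuple (OrderEmbedding.ofStrictMono _ hmono) = stdTuple v ∘ Tuple.sort v := rfl
  rw [h2, f.map_perm, g.map_perm] at h1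
  exact smul_left_cancel _ h1

/-- The elementary form `dx_{I_1} ∧ ⋯ ∧ dx_{I_a}`. -/
noncomputable def elementaryForm {a : ℕ} (I : Fin a → Fin k) :
    EuclideanSpace ℝ (Fin k) [⋀^Fin a]→ₗ[ℝ] ℝ :=
  Matrix.detRowAlternating.compLinearMap
    (LinearMap.pi fun l => (EuclideanSpace.proj (I l) : _ →L[ℝ] ℝ).toLinearMap)

theorem elementaryForm_stdTuple {a : ℕ} (I J : Fin a ↪o Fin k) :
    elementaryForm I (stdTuple J) = if I = J then 1 else 0 := by
  have h : elementaryForm I (stdTuple J) =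
      Matrix.det (Matrix.of fun j l => if I l = J j then (1 : ℝ) else 0) := by
    simp only [elementaryForm, AlternatingMap.compLinearMap_apply]
    change Matrix.det _ = _
    congr 1
    ext j l
    simp [stdTuple]
  rw [h]
  split_ifs with hIJ
  · subst hIJ
    rw [← Matrix.det_one (n := Fin a)]
    congr 1
    ext j l
    simp [Matrix.one_apply, eq_comm]
  · have hex : ∃ j, J j ∉ Set.range I := by
      by_contra hne
      push Not at hne
      apply hIJ
      have hsub : Set.range J ⊆ Set.range I := by
        rintro _ ⟨j, rfl⟩; exact hne j
      have hcard : (Set.range I).ncard ≤ (Set.range J).ncard := by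
        rw [← Set.image_univ, ← Set.image_univ, Set.ncard_image_of_injective _ I.injective,
          Set.ncard_image_of_injective _ J.injective]
      have := Set.eq_of_subset_of_ncard_le hsub hcard
      exact (OrderEmbedding.range_inj.1 this).symm
    obtain ⟨j, hj⟩ := hex
    refine Matrix.det_eq_zero_of_row_eq_zero j fun l => ?_
    rw [Matrix.of_apply, if_neg fun h => hj ⟨l, h⟩]

theorem sum_smul_elementaryForm {a : ℕ} (W : EuclideanSpace ℝ (Fin k) [⋀^Fin a]→ₗ[ℝ] ℝ) :
    W = ∑ I : Fin a ↪o Fin k, W (stdTuple I) • elementaryForm I := by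
  refine alternatingMap_ext_orderEmbedding fun J => ?_
  rw [alternatingMap_sum_apply]
  simp [elementaryForm_stdTuple]

/-- `W` is a form of class `W^{1,p}` on the unit ball, with weak derivative `D` (in all
directions). All index tuples `I` are allowed, not only the increasing ones. -/
def IsSobolevForm {a : ℕ} (p : ℝ≥0∞)
    (W : EuclideanSpace ℝ (Fin k) → EuclideanSpace ℝ (Fin k) [⋀^Fin a]→ₗ[ℝ] ℝ)
    (D : EuclideanSpace ℝ (Fin k) → EuclideanSpace ℝ (Fin k) →ₗ[ℝ]
      EuclideanSpace ℝ (Fin k) [⋀^Fin a]→ₗ[ℝ] ℝ) : Prop :=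
  ∀ I : Fin a → Fin k, HasWeakGradient p (ball 0 1) (fun y => W y (stdTuple I))
    fun i y => D y (EuclideanSpace.single i 1) (stdTuple I)

/-- A form whose coefficients with increasing indices are of class `W^{1,p}` has a weak derivative,
assembled from the weak partial derivatives of these coefficients. -/
theorem exists_isSobolevForm {a : ℕ} {p : ℝ≥0∞}
    {W : EuclideanSpace ℝ (Fin k) → EuclideanSpace ℝ (Fin k) [⋀^Fin a]→ₗ[ℝ] ℝ}
    (hW : ∀ I : Fin a ↪o Fin k, MemW1 p (ball 0 1) fun y => W y (stdTuple I)) :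
    ∃ D, IsSobolevForm p W D := by
  choose hLp g hg hgLp using hW
  refine ⟨fun y => ∑ I : Fin a ↪o Fin k, ∑ i : Fin k,
    (EuclideanSpace.proj i : _ →L[ℝ] ℝ).toLinearMap.smulRight (g I i y • elementaryForm I),
    fun I' => ?_⟩
  have h := HasWeakGradient.sum_const_mul Finset.univ
    (fun I _ => (⟨hLp I, hg I, hgLp I⟩ : HasWeakGradient p (ball 0 1) _ (g I)))
    fun I : Fin a ↪o Fin k => elementaryForm I (stdTuple I')
  convert h using 1
  · ext y
    conv_lhs => rw [sum_smul_elementaryForm (W y), alternatingMap_sum_apply]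
    refine Finset.sum_congr rfl fun I _ => ?_
    rw [AlternatingMap.smul_apply, smul_eq_mul, mul_comm]
  · ext i y
    rw [LinearMap.sum_apply, alternatingMap_sum_apply]
    refine Finset.sum_congr rfl fun I _ => ?_
    rw [LinearMap.sum_apply, alternatingMap_sum_apply, Finset.sum_eq_single i]
    · simp [mul_comm]
    · intro j _ hj
      simp [hj]
    · simp

/-- The weak exterior derivative, given in terms of strictly increasing indices,
is the alternatization of the full weak derivative. Its defining weak partial derivatives may differ
from those in `D` on a null set. -/
theorem IsSobolevForm.ae_eq_alternatizeUncurryFin {a : ℕ} {p : ℝ≥0∞}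
    {W : EuclideanSpace ℝ (Fin k) → EuclideanSpace ℝ (Fin k) [⋀^Fin a]→ₗ[ℝ] ℝ}
    {D : EuclideanSpace ℝ (Fin k) → EuclideanSpace ℝ (Fin k) →ₗ[ℝ]
      EuclideanSpace ℝ (Fin k) [⋀^Fin a]→ₗ[ℝ] ℝ}
    {Z : EuclideanSpace ℝ (Fin k) → EuclideanSpace ℝ (Fin k) [⋀^Fin (a + 1)]→ₗ[ℝ] ℝ}
    (hW : IsSobolevForm p W D)
    (hZ : ∀ J : Fin (a + 1) ↪o Fin k, ∃ g : Fin (a + 1) → EuclideanSpace ℝ (Fin k) → ℝ,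
      (∀ j, HasWeakPartial (ball 0 1) (J j)
        (fun y => W y (stdTuple fun i => J (j.succAbove i))) (g j)) ∧
      ∀ᵐ y ∂(volume.restrict (ball (0 : EuclideanSpace ℝ (Fin k)) 1)),
        Z y (stdTuple J) = ∑ j : Fin (a + 1), (-1) ^ (j : ℕ) * g j y) :
    ∀ᵐ y ∂(volume.restrict (ball (0 : EuclideanSpace ℝ (Fin k)) 1)),
      Z y = AlternatingMap.alternatizeUncurryFin (D y) := by
  have key : ∀ J : Fin (a + 1) ↪o Fin k,
      ∀ᵐ y ∂(volume.restrict (ball (0 : EuclideanSpace ℝ (Fin k)) 1)),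
        Z y (stdTuple J) = AlternatingMap.alternatizeUncurryFin (D y) (stdTuple J) := by
    intro J
    obtain ⟨g, hg, hZJ⟩ := hZ J
    have h1 : ∀ᵐ y ∂(volume.restrict (ball (0 : EuclideanSpace ℝ (Fin k)) 1)), ∀ j,
        g j y = D y (EuclideanSpace.single (J j) 1) (stdTuple fun i => J (j.succAbove i)) :=
      ae_all_iff.2 fun j => (hg j).ae_eq isOpen_ball
        ((hW fun i => J (j.succAbove i)).hasWeakPartial (J j))
    filter_upwards [hZJ, h1] with y hy1 hy2
    rw [hy1, AlternatingMap.alternatizeUncurryFin_apply]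
    refine Finset.sum_congr rfl fun j _ => ?_
    rw [hy2 j, zsmul_eq_mul]
    push_cast
    rfl
  filter_upwards [ae_all_iff.2 key] with y hy
  exact alternatingMap_ext_orderEmbedding hy

/-- The coefficient of `dx_i ∧ α ∧ β` is a bilinear form in the coefficients of `α` and `β`. -/
theorem exists_wedgeAt_coord_eq_sum {a b c : ℕ} (h : a + b = c) (h' : 1 + c = k) :
    ∃ (A : Equiv.Perm (Fin 1 ⊕ (Fin a ⊕ Fin b)) → Fin a → Fin k)
      (B : Equiv.Perm (Fin 1 ⊕ (Fin a ⊕ Fin b)) → Fin b → Fin k)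
      (K : Fin k → Equiv.Perm (Fin 1 ⊕ (Fin a ⊕ Fin b)) → ℝ),
      ∀ (i : Fin k) (α : EuclideanSpace ℝ (Fin k) [⋀^Fin a]→ₗ[ℝ] ℝ)
        (β : EuclideanSpace ℝ (Fin k) [⋀^Fin b]→ₗ[ℝ] ℝ),
        wedgeAt h' (oneForm ((EuclideanSpace.basisFun (Fin k) ℝ).toBasis.coord i))
          (wedgeAt h α β) (stdTuple id) =
        ∑ s, K i s * (α (stdTuple (A s)) * β (stdTuple (B s))) := by
  set E := (Equiv.sumCongr (Equiv.refl (Fin 1)) (finSumFinEquiv.trans (finCongr h))).trans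
        (finSumFinEquiv.trans (finCongr h'))
  refine ⟨fun s j => E (s (Sum.inr (Sum.inl j))), fun s j => E (s (Sum.inr (Sum.inr j))),
    fun i s => ((a.factorial : ℝ) * b.factorial)⁻¹ * (((Equiv.Perm.sign s : ℤ) : ℝ) *
      (EuclideanSpace.basisFun (Fin k) ℝ).toBasis.coord i
        (stdTuple id (E (s (Sum.inl 0))))), fun i α β => ?_⟩
  rw [wedgeAt_oneForm_wedgeAt, altSum, Finset.mul_sum]
  refine Finset.sum_congr rfl fun s _ => ?_
  rw [mul_assoc, mul_assoc]
  rfl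

/-- Stokes' theorem for `χ η ∧ ξ`, where `η` and `ξ` are forms of class `W^{1,p}` on the ball,
`η` is weakly closed, and `χ` is a test function. The number `ε` is the sign of
`exists_sum_wedgeAt_eq`.

Expanded in coefficients, `d(χ η ∧ ξ) = dχ ∧ η ∧ ξ + χ dη ∧ ξ ± χ η ∧ dξ` is a linear combination
of instances of `HasWeakGradient.integral_product_rule`. -/
theorem IsSobolevForm.integral_wedge_add {a : ℕ} {p q : ℝ≥0} (hpq : CriticalExponents k p q)
    {c : ℕ} (h : a + a = c) (h' : 1 + c = k) (h'' : a + (a + 1) = k)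
    {ε : ℝ} (hε0 : ε ≠ 0)
    (hε : ∀ {V : Type} [AddCommGroup V] [Module ℝ V]
      (e : Module.Basis (Fin k) ℝ V) (η : V [⋀^Fin a]→ₗ[ℝ] ℝ)
      (D : V →ₗ[ℝ] V [⋀^Fin a]→ₗ[ℝ] ℝ) (v : Fin k → V),
      ∑ i, wedgeAt h' (oneForm (e.coord i)) (wedgeAt h η (D (e i))) v =
        ε * wedgeAt h'' η (AlternatingMap.alternatizeUncurryFin D) v)
    {η ξ : EuclideanSpace ℝ (Fin k) → EuclideanSpace ℝ (Fin k) [⋀^Fin a]→ₗ[ℝ] ℝ}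
    {Dη Dξ : EuclideanSpace ℝ (Fin k) → EuclideanSpace ℝ (Fin k) →ₗ[ℝ]
      EuclideanSpace ℝ (Fin k) [⋀^Fin a]→ₗ[ℝ] ℝ}
    (hη : IsSobolevForm p η Dη) (hξ : IsSobolevForm p ξ Dξ)
    {χ : EuclideanSpace ℝ (Fin k) → ℝ} (hχ : ContDiff ℝ ∞ χ) (hχc : HasCompactSupport χ)
    (hχU : tsupport χ ⊆ ball 0 1) :
    Integrable (fun y => χ y * wedgeAt h'' (η y)
      (AlternatingMap.alternatizeUncurryFin (Dξ y)) (stdTuple id)) volume ∧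
    Integrable (fun y => wedgeAt h' (oneForm (fderiv ℝ χ y).toLinearMap)
      (wedgeAt h (η y) (ξ y)) (stdTuple id)) volume ∧
    ((∀ᵐ y ∂(volume.restrict (ball (0 : EuclideanSpace ℝ (Fin k)) 1)),
        AlternatingMap.alternatizeUncurryFin (Dη y) = 0) →
      ε * (∫ y, χ y * wedgeAt h'' (η y)
        (AlternatingMap.alternatizeUncurryFin (Dξ y)) (stdTuple id)) +
      ∫ y, wedgeAt h' (oneForm (fderiv ℝ χ y).toLinearMap)
        (wedgeAt h (η y) (ξ y)) (stdTuple id) = 0) := by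
  obtain ⟨A, B, K, hK⟩ := exists_wedgeAt_coord_eq_sum h h'
  set bs := (EuclideanSpace.basisFun (Fin k) ℝ).toBasis with hbs
  have hb : ∀ i, bs i = EuclideanSpace.single i (1 : ℝ) := fun i => by simp [hbs]
  have P := fun (i : Fin k) s => (hη (A s)).integral_product_rule hpq (hξ (B s)) hχ hχc hχU i
  -- the three integrands as sums over the coefficients
  have E1 : ∀ y, χ y * wedgeAt h'' (η y) (AlternatingMap.alternatizeUncurryFin (Dξ y))
      (stdTuple id) = ε⁻¹ * ∑ i, ∑ s, K i s * (χ y * (η y (stdTuple (A s)) *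
        Dξ y (EuclideanSpace.single i 1) (stdTuple (B s)))) := by
    intro y
    have := hε bs (η y) (Dξ y) (stdTuple id)
    simp only [hK, hb] at this
    rw [eq_inv_mul_iff_mul_eq₀ hε0, mul_left_comm, ← this, Finset.mul_sum]
    refine Finset.sum_congr rfl fun i _ => ?_
    rw [Finset.mul_sum]
    exact Finset.sum_congr rfl fun s _ => by ring
  have E2 : ∀ y, wedgeAt h' (oneForm (fderiv ℝ χ y).toLinearMap)
      (wedgeAt h (η y) (ξ y)) (stdTuple id) = ∑ i, ∑ s, K i s *
        (fderiv ℝ χ y (EuclideanSpace.single i 1) *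
          (η y (stdTuple (A s)) * ξ y (stdTuple (B s)))) := by
    intro y
    have h1 : oneForm (fderiv ℝ χ y).toLinearMap =
        ∑ i, fderiv ℝ χ y (EuclideanSpace.single i 1) • oneForm (bs.coord i) := by
      ext v
      rw [alternatingMap_sum_apply]
      simp only [oneForm_apply, AlternatingMap.smul_apply]
      conv_lhs => rw [← bs.sum_repr (v 0)]
      rw [map_sum]
      refine Finset.sum_congr rfl fun i _ => ?_
      rw [map_smul, hb, smul_eq_mul, smul_eq_mul, mul_comm]
      rfl
    have h2 := congrArg (fun w => wedgeRight h' (wedgeAt h (η y) (ξ y)) w (stdTuple id)) h1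
    simp only [map_sum, map_smul] at h2
    rw [alternatingMap_sum_apply] at h2
    refine h2.trans (Finset.sum_congr rfl fun i _ => ?_)
    rw [AlternatingMap.smul_apply, smul_eq_mul]
    have h3 : wedgeRight h' (wedgeAt h (η y) (ξ y)) (oneForm (bs.coord i)) (stdTuple id) = _ :=
      hK i (η y) (ξ y)
    rw [h3, Finset.mul_sum]
    exact Finset.sum_congr rfl fun s _ => by ring
  have I1 : ∀ i s, Integrable (fun y => K i s * (χ y * (η y (stdTuple (A s)) *
        Dξ y (EuclideanSpace.single i 1) (stdTuple (B s))))) volume :=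
    fun i s => (P i s).1.const_mul _
  have I2 : ∀ i s, Integrable (fun y => K i s * (χ y *
      (Dη y (EuclideanSpace.single i 1) (stdTuple (A s)) * ξ y (stdTuple (B s))))) volume :=
    fun i s => (P i s).2.1.const_mul _
  have I3 : ∀ i s, Integrable (fun y => K i s * (fderiv ℝ χ y (EuclideanSpace.single i 1) *
          (η y (stdTuple (A s)) * ξ y (stdTuple (B s))))) volume :=
    fun i s => (P i s).2.2.1.const_mul _
  refine ⟨?_, ?_, fun hd => ?_⟩
  · simp only [E1]
    exact (integrable_finsetSum _ fun i _ => integrable_finsetSum _ fun s _ => I1 i s).const_mul _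
  · simp only [E2]
    exact integrable_finsetSum _ fun i _ => integrable_finsetSum _ fun s _ => I3 i s
  · have E3 : ∀ᵐ y ∂(volume : Measure (EuclideanSpace ℝ (Fin k))),
        ∑ i, ∑ s, K i s * (χ y * (Dη y (EuclideanSpace.single i 1) (stdTuple (A s)) *
          ξ y (stdTuple (B s)))) = 0 := by
      rw [ae_restrict_iff' measurableSet_ball] at hd
      filter_upwards [hd] with y hy
      by_cases hyB : y ∈ ball (0 : EuclideanSpace ℝ (Fin k)) 1
      · have h1 := sum_wedgeAt_eq_zero h h' bs (Dη y) (hy hyB) (ξ y) (stdTuple id)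
        simp only [hK, hb] at h1
        rw [← mul_zero (χ y), ← h1, Finset.mul_sum]
        refine Finset.sum_congr rfl fun i _ => ?_
        rw [Finset.mul_sum]
        exact Finset.sum_congr rfl fun s _ => by ring
      · have : χ y = 0 := image_eq_zero_of_notMem_tsupport fun h => hyB (hχU h)
        simp [this]
    have E3' := integral_eq_zero_of_ae E3
    rw [integral_finsetSum _ fun i _ => integrable_finsetSum _ fun s _ => I2 i s] at E3'
    simp only [integral_finsetSum _ fun s _ => I2 _ s, integral_const_mul] at E3'
    simp only [E1, E2]
    rw [integral_const_mul, ← mul_assoc, mul_inv_cancel₀ hε0, one_mul,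
      integral_finsetSum _ fun i _ => integrable_finsetSum _ fun s _ => I1 i s,
      integral_finsetSum _ fun i _ => integrable_finsetSum _ fun s _ => I3 i s]
    simp only [integral_finsetSum _ fun s _ => I1 _ s, integral_finsetSum _ fun s _ => I3 _ s,
      integral_const_mul]
    have H : ∑ i, ∑ s, K i s * ((∫ y, χ y * (η y (stdTuple (A s)) *
          Dξ y (EuclideanSpace.single i 1) (stdTuple (B s)))) +
        (∫ y, χ y * (Dη y (EuclideanSpace.single i 1) (stdTuple (A s)) *
          ξ y (stdTuple (B s)))) +
        ∫ y, fderiv ℝ χ y (EuclideanSpace.single i 1) *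
          (η y (stdTuple (A s)) * ξ y (stdTuple (B s)))) = 0 :=
      Finset.sum_eq_zero fun i _ => Finset.sum_eq_zero fun s _ => by
        rw [(P i s).2.2.2, mul_zero]
    simp only [mul_add, Finset.sum_add_distrib] at H
    linarith

/-! ### Charts of the sphere and the surface measure -/

/-- The pullback of a form to the model space by the inverse of a chart. -/
noncomputable def chartPull {a : ℕ} (e : OpenPartialHomeomorph (Sph k) (EuclideanSpace ℝ (Fin k)))
    (w : DForm k (Sph k) a) (y : EuclideanSpace ℝ (Fin k)) :
    EuclideanSpace ℝ (Fin k) [⋀^Fin a]→ₗ[ℝ] ℝ :=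
  (w (e.symm y)).compLinearMap (mfderiv (𝓡 k) (𝓡 k) e.symm y).toLinearMap

theorem coef_eq_chartPull {a : ℕ} (e : OpenPartialHomeomorph (Sph k) (EuclideanSpace ℝ (Fin k)))
    (w : DForm k (Sph k) a) (I : Fin a → Fin k) (y : EuclideanSpace ℝ (Fin k)) :
    coef e w I y = chartPull e w y (stdTuple I) := rfl

/-- The inverse of a chart, as a map into the ambient Euclidean space. -/
def chartParam (e : OpenPartialHomeomorph (Sph k) (EuclideanSpace ℝ (Fin k)))
    (y : EuclideanSpace ℝ (Fin k)) : EuclideanSpace ℝ (Fin (k + 1)) := (e.symm y : Sph k)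

section Chart

variable {e : OpenPartialHomeomorph (Sph k) (EuclideanSpace ℝ (Fin k))}

theorem IsCoord.mdifferentiable (he : IsCoord e) : e.MDifferentiable (𝓡 k) (𝓡 k) :=
  ⟨(contMDiffOn_of_mem_maximalAtlas he.1).mdifferentiableOn (by simp),
    (contMDiffOn_symm_of_mem_maximalAtlas he.1).mdifferentiableOn (by simp)⟩

theorem IsCoord.ball_subset (he : IsCoord e) : ball 0 1 ⊆ e.target :=
  ball_subset_closedBall.trans he.2

theorem IsCoord.contDiffOn_chartParam (he : IsCoord e) :
    ContDiffOn ℝ ∞ (chartParam e) e.target := by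
  have : Fact (Module.finrank ℝ (EuclideanSpace ℝ (Fin (k + 1))) = k + 1) :=
    ⟨finrank_euclideanSpace_fin⟩
  have h := (contMDiff_coe_sphere (E := EuclideanSpace ℝ (Fin (k + 1))) (m := ∞)
    (n := k)).comp_contMDiffOn (contMDiffOn_symm_of_mem_maximalAtlas he.1)
  exact h.contDiffOn

theorem IsCoord.dIncl_mfderiv (he : IsCoord e) {y : EuclideanSpace ℝ (Fin k)}
    (hy : y ∈ e.target) (v : EuclideanSpace ℝ (Fin k)) :
    dIncl (e.symm y) (mfderiv (𝓡 k) (𝓡 k) e.symm y v) = fderiv ℝ (chartParam e) y v := by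
  have : Fact (Module.finrank ℝ (EuclideanSpace ℝ (Fin (k + 1))) = k + 1) :=
    ⟨finrank_euclideanSpace_fin⟩
  have h1 : MDifferentiableAt (𝓡 k) 𝓘(ℝ, EuclideanSpace ℝ (Fin (k + 1)))
      (Subtype.val : Sph k → EuclideanSpace ℝ (Fin (k + 1))) (e.symm y) :=
    (contMDiff_coe_sphere (m := 1) _).mdifferentiableAt one_ne_zero
  have h2 : MDifferentiableAt (𝓡 k) (𝓡 k) e.symm y :=
    he.mdifferentiable.mdifferentiableAt_symm hy
  have h3 := mfderiv_comp y h1 h2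
  have h4 : mfderiv (𝓡 k) 𝓘(ℝ, EuclideanSpace ℝ (Fin (k + 1))) (Subtype.val ∘ e.symm) y =
    fderiv ℝ (chartParam e) y := mfderiv_eq_fderiv
  rw [← h4, h3]
  rfl

/-- The Jacobian `J = det(Φ, ∂_1 Φ, …, ∂_k Φ)` of the inverse `Φ` of a chart, that is, the
coefficient of the volume form of the sphere in the chart. -/
noncomputable def chartJacobian (e : OpenPartialHomeomorph (Sph k) (EuclideanSpace ℝ (Fin k)))
    (y : EuclideanSpace ℝ (Fin k)) : ℝ :=
  (EuclideanSpace.basisFun (Fin (k + 1)) ℝ).toBasis.det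
    (Fin.cons (chartParam e y) fun i => fderiv ℝ (chartParam e) y (EuclideanSpace.single i 1))

theorem IsCoord.coef_sphereVol (he : IsCoord e) {y : EuclideanSpace ℝ (Fin k)}
    (hy : y ∈ e.target) :
    coef e (sphereVol k) id y = chartJacobian e y := by
  unfold coef sphereVol chartJacobian
  rw [AlternatingMap.compLinearMap_apply, AlternatingMap.curryLeft_apply_apply]
  congr 1
  ext i : 1
  refine Fin.cases ?_ (fun j => ?_) i
  · rfl
  · exact he.dIncl_mfderiv hy _

theorem IsCoord.coef_eq_density_mul (he : IsCoord e) {y : EuclideanSpace ℝ (Fin k)}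
    (hy : y ∈ e.target) (θ : DForm k (Sph k) k) :
    coef e θ id y = density θ (e.symm y) * chartJacobian e y := by
  rw [← he.coef_sphereVol hy]
  exact eq_density_mul_vol θ (e.symm y) _

theorem IsCoord.chartJacobian_ne_zero (he : IsCoord e) {y : EuclideanSpace ℝ (Fin k)}
    (hy : y ∈ e.target) :
    chartJacobian e y ≠ 0 := by
  intro h0
  -- every top degree form is a multiple of the volume form, so that the determinant form of the
  -- model space, which does not vanish on the coordinate frame, excludes `J = 0`
  have hbij : Function.Injective (mfderiv (𝓡 k) (𝓡 k) e.symm y) :=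
    he.mdifferentiable.symm.mfderiv_injective hy
  let L : EuclideanSpace ℝ (Fin k) →ₗ[ℝ] EuclideanSpace ℝ (Fin k) :=
    (mfderiv (𝓡 k) (𝓡 k) e.symm y).toLinearMap
  have hL : Function.Injective L := hbij
  set b := (EuclideanSpace.basisFun (Fin k) ℝ).toBasis with hb
  have hbi : ∀ i, b i = EuclideanSpace.single i (1 : ℝ) := fun i => by simp [hb]
  let θ : DForm k (Sph k) k := fun _ => b.det
  have h1 := he.coef_eq_density_mul hy θ
  rw [h0, mul_zero] at h1
  have h2 : coef e θ id y = b.det (L ∘ b) := by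
    have : (L ∘ b) = fun j => L (EuclideanSpace.single j (1 : ℝ)) := by
      ext j : 1
      rw [Function.comp_apply, hbi]
    rw [this]
    rfl
  rw [h2, Module.Basis.det_comp, b.det_self, mul_one] at h1
  exact (LinearEquiv.ofInjectiveEndo L hL).isUnit_det'.ne_zero h1

theorem IsCoord.continuousOn_chartJacobian (he : IsCoord e) :
    ContinuousOn (chartJacobian e) e.target := by
  have h1 := he.contDiffOn_chartParam
  have h2 : ContinuousOn (fderiv ℝ (chartParam e)) e.target :=
    h1.continuousOn_fderiv_of_isOpen e.open_target (by simp)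
  have h3 : Continuous fun v : Fin (k + 1) → EuclideanSpace ℝ (Fin (k + 1)) =>
      (EuclideanSpace.basisFun (Fin (k + 1)) ℝ).toBasis.det v := by
    simp only [Module.Basis.det_apply]
    refine Continuous.matrix_det ?_
    refine continuous_matrix fun i j => ?_
    simp only [Module.Basis.toMatrix_apply, OrthonormalBasis.coe_toBasis_repr_apply,
      EuclideanSpace.basisFun_repr]
    fun_prop
  refine h3.comp_continuousOn (continuousOn_pi.2 fun i => ?_)
  refine Fin.cases ?_ (fun j => ?_) i
  · exact h1.continuousOn
  · exact h2.clm_apply continuousOn_const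

end Chart

/-- Splitting off the first coordinate of a Euclidean space preserves the volume. -/
theorem measurePreserving_head_tail : MeasurePreserving
    (fun z : EuclideanSpace ℝ (Fin (k + 1)) =>
      (z 0, (WithLp.toLp 2 fun i : Fin k => z i.succ : EuclideanSpace ℝ (Fin k))))
    volume (volume.prod volume) := by
  have h1 := PiLp.volume_preserving_ofLp (Fin (k + 1))
  have h2 := volume_preserving_piFinSuccAbove (fun _ : Fin (k + 1) => ℝ) 0
  have h3 : MeasurePreserving (Prod.map (id : ℝ → ℝ) (WithLp.toLp 2 : (Fin k → ℝ) → _))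
      (volume.prod volume) (volume.prod volume) :=
    (MeasurePreserving.id volume).prod (PiLp.volume_preserving_toLp (Fin k))
  exact h3.comp (h2.comp h1)

theorem lintegral_Ioo_pow : ∫⁻ r in Ioo (0 : ℝ) 1, ENNReal.ofReal (r ^ k) =
    ENNReal.ofReal (1 / ((k : ℝ) + 1)) := by
  rw [Measure.restrict_congr_set Ioo_ae_eq_Ioc,
    ← ofReal_integral_eq_lintegral_ofReal (intervalIntegral.intervalIntegrable_pow k).1,
    ← intervalIntegral.integral_of_le zero_le_one, integral_pow]
  · simp
  · filter_upwards [ae_restrict_mem measurableSet_Ioc] with y hy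
    exact pow_nonneg hy.1.le _

section Cone

variable {e : OpenPartialHomeomorph (Sph k) (EuclideanSpace ℝ (Fin k))}

/-- The change of variables formula for the surface measure of the sphere. By definition, `surf` of
a set is `k + 1` times the volume of the cone over it, and the cone over `e.symm '' s` is the image
of `(0, 1) × s` under `(r, y) ↦ r Φ(y)`, whose Jacobian determinant is `r ^ k J(y)`. -/
theorem IsCoord.surf_image (he : IsCoord e) {s : Set (EuclideanSpace ℝ (Fin k))}
    (hs : MeasurableSet s) (hsB : s ⊆ ball 0 1) :
    surf k (e.symm '' s) = ∫⁻ y in s, ‖chartJacobian e y‖ₑ := by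
  have hst : s ⊆ e.target := hsB.trans he.ball_subset
  have himg : MeasurableSet (e.symm '' s) := by
    have hme := ContinuousOn.measurableEmbedding (s := s) hs
      (e.continuousOn_symm.mono hst) (e.symm.injOn.mono hst)
    have := hme.measurableSet_range
    rwa [Set.range_domRestrict] at this
  let τ : EuclideanSpace ℝ (Fin (k + 1)) →L[ℝ] EuclideanSpace ℝ (Fin k) :=
    LinearMap.toContinuousLinearMap
      { toFun := fun z => WithLp.toLp 2 fun i : Fin k => z i.succ
        map_add' := fun _ _ => rfl
        map_smul' := fun _ _ => rfl }
  have hτ : ∀ z, τ z = WithLp.toLp 2 fun i : Fin k => z i.succ := fun _ => rfl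
  -- the first coordinate of `z` is the radius, the others are the coordinates on the sphere
  set S : Set (EuclideanSpace ℝ (Fin (k + 1))) := {z | z 0 ∈ Ioo (0 : ℝ) 1 ∧ τ z ∈ s} with hS
  have hSm : MeasurableSet S :=
    (measurableSet_Ioo.preimage (by fun_prop)).inter (hs.preimage τ.continuous.measurable)
  let f : EuclideanSpace ℝ (Fin (k + 1)) → EuclideanSpace ℝ (Fin (k + 1)) :=
    fun z => z 0 • chartParam e (τ z)
  let f' : EuclideanSpace ℝ (Fin (k + 1)) →
      EuclideanSpace ℝ (Fin (k + 1)) →L[ℝ] EuclideanSpace ℝ (Fin (k + 1)) := fun z =>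
    z 0 • (fderiv ℝ (chartParam e) (τ z)).comp τ +
      (EuclideanSpace.proj 0 : _ →L[ℝ] ℝ).smulRight (chartParam e (τ z))
  have hf' : ∀ z ∈ S, HasFDerivWithinAt f (f' z) S z := by
    intro z hz
    have h1 : HasFDerivAt (chartParam e) (fderiv ℝ (chartParam e) (τ z)) (τ z) :=
      ((he.contDiffOn_chartParam.contDiffAt
        (e.open_target.mem_nhds (hst hz.2))).differentiableAt (by simp)).hasFDerivAt
    have h2 : HasFDerivAt (fun z : EuclideanSpace ℝ (Fin (k + 1)) => z 0)
      (EuclideanSpace.proj 0 : _ →L[ℝ] ℝ) z := (EuclideanSpace.proj 0 : _ →L[ℝ] ℝ).hasFDerivAt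
    exact (h2.smul (h1.comp z τ.hasFDerivAt)).hasFDerivWithinAt
  have hnorm : ∀ y, ‖chartParam e y‖ = 1 := fun y => by
    have := (e.symm y).2
    rwa [mem_sphere_zero_iff_norm] at this
  have hinj : InjOn f S := by
    intro z hz z' hz' hzz
    have h0 : z 0 = z' 0 := by
      have := congrArg norm hzz
      simp only [f, norm_smul, hnorm, mul_one, Real.norm_of_nonneg hz.1.1.le,
        Real.norm_of_nonneg hz'.1.1.le] at this
      exact this
    have h1 : chartParam e (τ z) = chartParam e (τ z') := by
      simp only [f, h0] at hzz
      exact smul_right_injective _ hz'.1.1.ne' hzz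
    have h2 : τ z = τ z' := e.symm.injOn (hst hz.2) (hst hz'.2) (Subtype.ext h1)
    ext i
    refine Fin.cases h0 (fun j => ?_) i
    have := congrArg (fun w : EuclideanSpace ℝ (Fin k) => w j) h2
    exact this
  have hfS : f '' S = Ioo (0 : ℝ) 1 • (Subtype.val '' (e.symm '' s)) := by
    ext x
    simp only [mem_image, Set.mem_smul]
    constructor
    · rintro ⟨z, hz, rfl⟩
      exact ⟨z 0, hz.1, chartParam e (τ z), ⟨e.symm (τ z), ⟨τ z, hz.2, rfl⟩, rfl⟩, rfl⟩
    · rintro ⟨r, hr, _, ⟨_, ⟨y, hy, rfl⟩, rfl⟩, rfl⟩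
      refine ⟨WithLp.toLp 2 (Fin.cons r y), ⟨hr, ?_⟩, ?_⟩
      · exact hy
      · rfl
  have hdet : ∀ z ∈ S, ENNReal.ofReal |(f' z).det| =
      ENNReal.ofReal (z 0 ^ k) * ‖chartJacobian e (τ z)‖ₑ := by
    intro z hz
    set b := (EuclideanSpace.basisFun (Fin (k + 1)) ℝ).toBasis with hb
    have hbi : ∀ i, b i = EuclideanSpace.single i (1 : ℝ) := fun i => by simp [hb]
    have h1 : (f' z).det = z 0 ^ k * chartJacobian e (τ z) := by
      have h2 := b.det_comp (f' z).toLinearMap b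
      rw [b.det_self, mul_one] at h2
      have h3 : (⇑(f' z).toLinearMap ∘ ⇑b) = Matrix.vecCons (chartParam e (τ z)) fun i : Fin k =>
          z 0 • fderiv ℝ (chartParam e) (τ z) (EuclideanSpace.single i 1) := by
        ext i : 1
        refine Fin.cases ?_ (fun j => ?_) i
        · have : τ (EuclideanSpace.single 0 1) = 0 := by
            rw [hτ]; ext i; simp
          simp [hbi, f', this]
        · have : τ (EuclideanSpace.single j.succ 1) = EuclideanSpace.single j 1 := by
            rw [hτ]; ext i; simp
          simp [hbi, f', this]
      have h4 := (b.det.curryLeft (chartParam e (τ z))).map_smul_univ (fun _ : Fin k => z 0)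
        fun i : Fin k => fderiv ℝ (chartParam e) (τ z) (EuclideanSpace.single i 1)
      rw [AlternatingMap.curryLeft_apply_apply, ← h3, h2, Finset.prod_const, Finset.card_univ,
        Fintype.card_fin, smul_eq_mul] at h4
      exact h4
    rw [h1, abs_mul, abs_of_nonneg (pow_nonneg hz.1.1.le k),
      ENNReal.ofReal_mul (pow_nonneg hz.1.1.le k), Real.enorm_eq_ofReal_abs]
  have hmeasJ : AEMeasurable (fun y => ‖chartJacobian e y‖ₑ) (volume.restrict s) :=
    ((he.continuousOn_chartJacobian.mono hst).aemeasurable hs).enorm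
  have hprod : ∫⁻ z in S, ENNReal.ofReal (z 0 ^ k) * ‖chartJacobian e (τ z)‖ₑ =
      (∫⁻ r in Ioo (0 : ℝ) 1, ENNReal.ofReal (r ^ k)) * ∫⁻ y in s, ‖chartJacobian e y‖ₑ := by
    rw [← lintegral_prod_mul (by fun_prop) hmeasJ, Measure.prod_restrict]
    have h1 := (measurePreserving_head_tail (k := k)).restrict_preimage
      (measurableSet_Ioo.prod hs : MeasurableSet (Ioo (0 : ℝ) 1 ×ˢ s))
    rw [← h1.map_eq, lintegral_map' _ h1.measurable.aemeasurable]
    · rfl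
    · rw [h1.map_eq, ← Measure.prod_restrict]
      exact (Measurable.aemeasurable (by fun_prop)).mul hmeasJ.comp_snd
  rw [surf, Measure.toSphere_apply' _ himg, ← hfS,
    ← lintegral_abs_det_fderiv_eq_addHaar_image volume hSm hf' hinj,
    setLIntegral_congr_fun hSm hdet, hprod, lintegral_Ioo_pow, ← mul_assoc,
    finrank_euclideanSpace_fin, ← ENNReal.ofReal_natCast, ← ENNReal.ofReal_mul (by positivity)]
  have : ((k + 1 : ℕ) : ℝ) * (1 / ((k : ℝ) + 1)) = 1 := by
    push_cast; field_simp
  rw [this, ENNReal.ofReal_one, one_mul]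

end Cone

/-! ### Integration of forms in a chart -/

section Patch

variable {e : OpenPartialHomeomorph (Sph k) (EuclideanSpace ℝ (Fin k))}

/-- The coordinate patch `e⁻¹(B(0,1))`. -/
def coordPatch (e : OpenPartialHomeomorph (Sph k) (EuclideanSpace ℝ (Fin k))) : Set (Sph k) :=
  e.symm '' ball 0 1

theorem IsCoord.coordPatch_eq (he : IsCoord e) :
    coordPatch e = e.source ∩ e ⁻¹' ball 0 1 := by
  rw [coordPatch, e.symm_image_eq_source_inter_preimage he.ball_subset]

theorem IsCoord.isOpen_coordPatch (he : IsCoord e) : IsOpen (coordPatch e) :=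
  e.isOpen_image_symm_of_subset_target isOpen_ball he.ball_subset

theorem IsCoord.measurableEmbedding_symm (he : IsCoord e) :
    MeasurableEmbedding ((ball (0 : EuclideanSpace ℝ (Fin k)) 1).domRestrict e.symm) :=
  ContinuousOn.measurableEmbedding measurableSet_ball
    (e.continuousOn_symm.mono he.ball_subset) (e.symm.injOn.mono he.ball_subset)

theorem IsCoord.measurable_chartJacobian (he : IsCoord e) :
    Measurable fun y : ball (0 : EuclideanSpace ℝ (Fin k)) 1 => chartJacobian e y :=
  (continuousOn_iff_continuous_domRestrict.1
    (he.continuousOn_chartJacobian.mono he.ball_subset)).measurable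

/-- In a chart the surface measure has the density `|J|`. -/
theorem IsCoord.map_withDensity (he : IsCoord e) :
    Measure.map ((ball (0 : EuclideanSpace ℝ (Fin k)) 1).domRestrict e.symm)
      ((Measure.comap Subtype.val volume).withDensity
        fun y : ball (0 : EuclideanSpace ℝ (Fin k)) 1 => ‖chartJacobian e y‖ₑ) =
      (surf k).restrict (coordPatch e) := by
  ext A hA
  have hme := he.measurableEmbedding_symm
  have hpre := hme.measurable hA
  rw [hme.map_apply, Measure.restrict_apply hA, withDensity_apply _ hpre,
    setLIntegral_subtype measurableSet_ball _ fun y => ‖chartJacobian e y‖ₑ,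
    ← he.surf_image (measurableSet_ball.subtype_image hpre)
      (by rintro _ ⟨y, _, rfl⟩; exact y.2)]
  congr 1
  ext x
  constructor
  · rintro ⟨_, ⟨y, hy, rfl⟩, rfl⟩
    exact ⟨hy, ⟨y, y.2, rfl⟩⟩
  · rintro ⟨hx, ⟨y, hy, rfl⟩⟩
    exact ⟨y, ⟨⟨y, hy⟩, hx, rfl⟩, rfl⟩

/-- Charts map null sets to null sets, as `J` does not vanish. -/
theorem IsCoord.ae_of_ae_surf (he : IsCoord e) {P : Sph k → Prop} (h : ∀ᵐ x ∂(surf k), P x) :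
    ∀ᵐ y ∂(volume.restrict (ball (0 : EuclideanSpace ℝ (Fin k)) 1)), P (e.symm y) := by
  have h1 := ae_restrict_of_ae (s := coordPatch e) h
  rw [← he.map_withDensity, he.measurableEmbedding_symm.ae_map_iff,
    ae_withDensity_iff he.measurable_chartJacobian.enorm] at h1
  rw [← map_comap_subtype_coe measurableSet_ball,
    (MeasurableEmbedding.subtype_coe measurableSet_ball).ae_map_iff]
  filter_upwards [h1] with y hy
  exact hy (by simpa using he.chartJacobian_ne_zero (he.ball_subset y.2))

/-- The Jacobian has constant sign on the connected coordinate ball. -/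
theorem IsCoord.exists_sign (he : IsCoord e) : ∃ s : ℝ, s ≠ 0 ∧
    ∀ y ∈ ball (0 : EuclideanSpace ℝ (Fin k)) 1, |chartJacobian e y| = s * chartJacobian e y := by
  have hconn : IsPreconnected (ball (0 : EuclideanSpace ℝ (Fin k)) 1) :=
    (convex_ball 0 1).isPreconnected
  have hcont := he.continuousOn_chartJacobian.mono he.ball_subset
  have h0 : (0 : EuclideanSpace ℝ (Fin k)) ∈ ball (0 : EuclideanSpace ℝ (Fin k)) 1 := by simp
  have hne : ∀ y ∈ ball (0 : EuclideanSpace ℝ (Fin k)) 1, chartJacobian e y ≠ 0 :=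
    fun y hy => he.chartJacobian_ne_zero (he.ball_subset hy)
  rcases (hne 0 h0).lt_or_gt with hneg | hpos
  · refine ⟨-1, by norm_num, fun y hy => ?_⟩
    rw [abs_of_neg, neg_one_mul]
    by_contra hy0
    obtain ⟨z, hz, hz0⟩ := hconn.intermediate_value h0 hy hcont ⟨hneg.le, not_lt.1 hy0⟩
    exact hne z hz hz0
  · refine ⟨1, by norm_num, fun y hy => ?_⟩
    rw [abs_of_pos, one_mul]
    by_contra hy0
    obtain ⟨z, hz, hz0⟩ := hconn.intermediate_value hy h0 hcont ⟨not_lt.1 hy0, hpos.le⟩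
    exact hne z hz hz0

/-- Integration of top degree forms in a chart. The constant is the orientation of the chart. -/
theorem IsCoord.exists_integral_eq (he : IsCoord e) : ∃ s : ℝ, s ≠ 0 ∧
    ∀ θ : DForm k (Sph k) k,
      (IntegrableOn (density θ) (coordPatch e) (surf k) ↔
        IntegrableOn (coef e θ id) (ball 0 1)) ∧
      ∫ x in coordPatch e, density θ x ∂(surf k) = s * ∫ y in ball 0 1, coef e θ id y := by
  obtain ⟨s, hs, hsJ⟩ := he.exists_sign
  refine ⟨s, hs, fun θ => ?_⟩
  have hJ : ∀ y : ball (0 : EuclideanSpace ℝ (Fin k)) 1,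
      ‖chartJacobian e y‖ * density θ (e.symm y) = s * coef e θ id y := by
    intro y
    rw [he.coef_eq_density_mul (he.ball_subset y.2), Real.norm_eq_abs, hsJ y y.2]
    ring
  have hJm := he.measurable_chartJacobian
  constructor
  · rw [IntegrableOn, ← he.map_withDensity, he.measurableEmbedding_symm.integrable_map_iff,
      integrable_withDensity_iff_integrable_smul' hJm.enorm (by simp),
      integrableOn_iff_comap_subtypeVal measurableSet_ball]
    have h1 : (fun y : ball (0 : EuclideanSpace ℝ (Fin k)) 1 => (‖chartJacobian e y‖ₑ).toReal •
        (density θ ∘ (ball (0 : EuclideanSpace ℝ (Fin k)) 1).domRestrict e.symm) y) =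
        fun y => s * (coef e θ id ∘ Subtype.val) y := by
      ext y
      rw [toReal_enorm, smul_eq_mul]
      exact hJ y
    rw [h1, integrable_const_mul_iff (isUnit_iff_ne_zero.2 hs)]
  · rw [← he.map_withDensity, he.measurableEmbedding_symm.integral_map]
    have h2 := integral_withDensity_eq_integral_smul (μ := Measure.comap Subtype.val volume)
      hJm.nnnorm fun y : ball (0 : EuclideanSpace ℝ (Fin k)) 1 =>
        density θ ((ball (0 : EuclideanSpace ℝ (Fin k)) 1).domRestrict e.symm y)
    refine h2.trans ?_
    rw [← integral_const_mul, ← integral_subtype_comap measurableSet_ball]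
    refine integral_congr_ae (.of_forall fun y => ?_)
    exact hJ y

/-- A smooth function on the sphere with support in a coordinate patch, read in the chart and
extended by zero, is a test function on the ball. -/
theorem IsCoord.exists_contDiff_read (he : IsCoord e) {χ : Sph k → ℝ}
    (hχ : ContMDiff (𝓡 k) 𝓘(ℝ) ∞ χ) (hχU : tsupport χ ⊆ coordPatch e) :
    ∃ χ' : EuclideanSpace ℝ (Fin k) → ℝ, ContDiff ℝ ∞ χ' ∧ HasCompactSupport χ' ∧
      tsupport χ' ⊆ ball 0 1 ∧ ∀ y ∈ ball (0 : EuclideanSpace ℝ (Fin k)) 1,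
        χ' =ᶠ[𝓝 y] χ ∘ e.symm := by
  have hU := he.coordPatch_eq
  set C : Set (EuclideanSpace ℝ (Fin k)) := e '' tsupport χ with hC
  have hCc : IsCompact C := (isClosed_tsupport χ).isCompact.image_of_continuousOn
    (e.continuousOn.mono fun x hx => ((hU ▸ hχU) hx).1)
  have hCB : C ⊆ ball 0 1 := by
    rintro _ ⟨x, hx, rfl⟩
    exact ((hU ▸ hχU) hx).2
  let χ' : EuclideanSpace ℝ (Fin k) → ℝ := (ball 0 1).indicator (χ ∘ e.symm)
  have hin : ∀ y ∈ ball (0 : EuclideanSpace ℝ (Fin k)) 1, χ' =ᶠ[𝓝 y] χ ∘ e.symm := by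
    intro y hy
    filter_upwards [isOpen_ball.mem_nhds hy] with z hz
    exact indicator_of_mem hz _
  have hout : ∀ y ∉ C, χ' y = 0 := by
    intro y hy
    by_cases hyB : y ∈ ball (0 : EuclideanSpace ℝ (Fin k)) 1
    · have : χ' y = χ (e.symm y) := indicator_of_mem hyB _
      rw [this]
      refine image_eq_zero_of_notMem_tsupport fun h => hy ⟨_, h, ?_⟩
      exact e.right_inv (he.ball_subset hyB)
    · exact indicator_of_notMem hyB _
  have hsupp : tsupport χ' ⊆ C := closure_minimal (fun y hy => by
    by_contra hyC; exact hy (hout y hyC)) hCc.isClosed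
  refine ⟨χ', contDiff_iff_contDiffAt.2 fun y => ?_, hCc.of_isClosed_subset
    (isClosed_tsupport _) hsupp, hsupp.trans hCB, hin⟩
  by_cases hyC : y ∈ C
  · have hyB := hCB hyC
    have h1 : ContMDiffOn (𝓡 k) 𝓘(ℝ) ∞ (χ ∘ e.symm) e.target :=
      hχ.comp_contMDiffOn (contMDiffOn_symm_of_mem_maximalAtlas he.1)
    exact (h1.contDiffOn.contDiffAt
      (e.open_target.mem_nhds (he.ball_subset hyB))).congr_of_eventuallyEq (hin y hyB)
  · have : χ' =ᶠ[𝓝 y] fun _ => 0 := by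
      filter_upwards [hCc.isClosed.isOpen_compl.mem_nhds hyC] with z hz
      exact hout z hz
    exact contDiffAt_const.congr_of_eventuallyEq this

/-- The differential of a function on the sphere, as a form of degree one. -/
noncomputable def dFun (χ : Sph k → ℝ) : DForm k (Sph k) 1 := fun x =>
  oneForm (mvfderiv (𝓡 k) χ x).toLinearMap

theorem wedge_apply {a b c : ℕ} (h : a + b = c) (w : DForm k (Sph k) a) (ζ : DForm k (Sph k) b)
    (x : Sph k) : wedge h w ζ x = wedgeAt h (w x) (ζ x) := rfl

theorem chartPull_wedge {a b c : ℕ} (h : a + b = c) (w : DForm k (Sph k) a)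
    (ζ : DForm k (Sph k) b) (y : EuclideanSpace ℝ (Fin k)) :
    chartPull e (wedge h w ζ) y = wedgeAt h (chartPull e w y) (chartPull e ζ y) :=
  wedgeAt_compLinearMap h (w (e.symm y)) (ζ (e.symm y)) _

theorem IsCoord.chartPull_dFun (he : IsCoord e) {χ : Sph k → ℝ}
    (hχ : ContMDiff (𝓡 k) 𝓘(ℝ) ∞ χ) {y : EuclideanSpace ℝ (Fin k)} (hy : y ∈ e.target) :
    chartPull e (dFun χ) y = oneForm (fderiv ℝ (χ ∘ e.symm) y).toLinearMap := by
  have h1 : MDifferentiableAt (𝓡 k) 𝓘(ℝ) χ (e.symm y) :=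
    (hχ _).mdifferentiableAt (by simp)
  have h2 : MDifferentiableAt (𝓡 k) (𝓡 k) e.symm y :=
    he.mdifferentiable.mdifferentiableAt_symm hy
  have h3 := mfderiv_comp y h1 h2
  have h4 : mfderiv (𝓡 k) 𝓘(ℝ) (χ ∘ e.symm) y = fderiv ℝ (χ ∘ e.symm) y := mfderiv_eq_fderiv
  rw [← h4, h3]
  rfl

end Patch

/-! ### Linearity and monotonicity of the Sobolev conditions -/

section LocalLinearity

variable {U : Set (EuclideanSpace ℝ (Fin k))} {u v : EuclideanSpace ℝ (Fin k) → ℝ}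

theorem HasWeakPartial.sub {i : Fin k} {g h : EuclideanSpace ℝ (Fin k) → ℝ}
    (hu : HasWeakPartial U i u g) (hv : HasWeakPartial U i v h) :
    HasWeakPartial U i (fun y => u y - v y) (fun y => g y - h y) := by
  have := hu.add (hv.const_mul (-1))
  simpa only [neg_one_mul, ← sub_eq_add_neg] using this

theorem MemW1.sub {p : ℝ≥0∞} (hu : MemW1 p U u) (hv : MemW1 p U v) :
    MemW1 p U fun y => u y - v y := by
  refine ⟨hu.1.sub hv.1, fun i => ?_⟩
  obtain ⟨g, hg, hgp⟩ := hu.2 i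
  obtain ⟨h, hh, hhp⟩ := hv.2 i
  exact ⟨_, hg.sub hh, hgp.sub hhp⟩

theorem MemW1.mono_exponent {p q : ℝ≥0∞} (hpq : p ≤ q) (hU : volume U ≠ ⊤) (hu : MemW1 q U u) :
    MemW1 p U u := by
  have : IsFiniteMeasure ((volume : Measure (EuclideanSpace ℝ (Fin k))).restrict U) :=
    ⟨by simpa using hU.lt_top⟩
  refine ⟨hu.1.mono_exponent hpq, fun i => ?_⟩
  obtain ⟨g, hg, hgp⟩ := hu.2 i
  exact ⟨g, hg, hgp.mono_exponent hpq⟩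

end LocalLinearity

theorem FormMemW1.mono_exponent {a : ℕ} {p q : ℝ≥0∞} (hpq : p ≤ q) {w : DForm k (Sph k) a}
    (hw : FormMemW1 q w) : FormMemW1 p w := fun e he I =>
  (hw e he I).mono_exponent hpq measure_ball_lt_top.ne

theorem FormMemW1.sub {a : ℕ} {p : ℝ≥0∞} {w w' : DForm k (Sph k) a}
    (hw : FormMemW1 p w) (hw' : FormMemW1 p w') : FormMemW1 p fun x => w x - w' x :=
  fun e he I => (hw e he I).sub (hw' e he I)

theorem HasWeakExtDeriv.sub {a b : ℕ} {h : a + 1 = b} {w w' : DForm k (Sph k) a}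
    {ζ ζ' : DForm k (Sph k) b} (hw : HasWeakExtDeriv h w ζ) (hw' : HasWeakExtDeriv h w' ζ') :
    HasWeakExtDeriv h (fun x => w x - w' x) fun x => ζ x - ζ' x := by
  intro e he J
  obtain ⟨g, hg, hgζ⟩ := hw e he J
  obtain ⟨g', hg', hgζ'⟩ := hw' e he J
  refine ⟨fun j y => g j y - g' j y, fun j => (hg j).sub (hg' j), ?_⟩
  filter_upwards [hgζ, hgζ'] with y hy hy'
  simp only [mul_sub, Finset.sum_sub_distrib]
  rw [← hy, ← hy']
  rfl

/-! ### Partitions of unity and Stokes' theorem on the sphere -/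

/-- The stereographic charts are admissible, since they map onto the whole model space. -/
theorem isCoord_chartAt (x : Sph k) : IsCoord (chartAt (EuclideanSpace ℝ (Fin k)) x) := by
  refine ⟨IsManifold.chart_mem_maximalAtlas x, ?_⟩
  have : (chartAt (EuclideanSpace ℝ (Fin k)) x).target = univ := by
    simp [chartAt, ChartedSpace.chartAt]
  rw [this]
  exact subset_univ _

/-- The stereographic chart at `x` is centered at `x`. -/
theorem mem_coordPatch_chartAt (x : Sph k) :
    x ∈ coordPatch (chartAt (EuclideanSpace ℝ (Fin k)) x) := by
  rw [(isCoord_chartAt x).coordPatch_eq]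
  refine ⟨mem_chart_source _ x, ?_⟩
  have : chartAt (EuclideanSpace ℝ (Fin k)) x x = 0 := by
    have : Fact (Module.finrank ℝ (EuclideanSpace ℝ (Fin (k + 1))) = k + 1) :=
      ⟨finrank_euclideanSpace_fin⟩
    change (OrthonormalBasis.fromOrthogonalSpanSingleton (𝕜 := ℝ) k
      (ne_zero_of_mem_unit_sphere (-x))).repr
        (stereographic (norm_eq_of_mem_sphere (-x)) x) = 0
    rw [stereographic_neg_apply, map_zero]
  rw [mem_preimage, this]
  simp

/-- The sphere has a finite smooth partition of unity subordinate to coordinate patches. -/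
theorem exists_finite_partition (k : ℕ) : ∃ (t : Finset (Sph k)) (χ : t → Sph k → ℝ),
    (∀ i, ContMDiff (𝓡 k) 𝓘(ℝ) ∞ (χ i)) ∧
    (∀ i : t, tsupport (χ i) ⊆ coordPatch (chartAt (EuclideanSpace ℝ (Fin k)) (i : Sph k))) ∧
    ∀ x, ∑ i, χ i x = 1 := by
  obtain ⟨t, ht⟩ := isCompact_univ.elim_finite_subcover
    (fun x : Sph k => coordPatch (chartAt (EuclideanSpace ℝ (Fin k)) x))
    (fun x => (isCoord_chartAt x).isOpen_coordPatch)
    fun x _ => mem_iUnion.2 ⟨x, mem_coordPatch_chartAt x⟩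
  obtain ⟨f, hf⟩ := SmoothPartitionOfUnity.exists_isSubordinate (𝓡 k) (isClosed_univ (X := Sph k))
    (fun i : t => coordPatch (chartAt (EuclideanSpace ℝ (Fin k)) (i : Sph k)))
    (fun i => (isCoord_chartAt _).isOpen_coordPatch)
    (ht.trans fun x hx => by
      obtain ⟨i, hi, hx⟩ := mem_iUnion₂.1 hx
      exact mem_iUnion.2 ⟨⟨i, hi⟩, hx⟩)
  refine ⟨t, fun i => f i, fun i => (f i).contMDiff, hf, fun x => ?_⟩
  rw [← finsum_eq_sum_of_fintype]
  exact f.sum_eq_one (mem_univ x)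

theorem mvfderiv_sum {α : Type*} (s : Finset α) {χ : α → Sph k → ℝ}
    (hχ : ∀ i, ContMDiff (𝓡 k) 𝓘(ℝ) ∞ (χ i)) (x : Sph k) :
    mvfderiv (𝓡 k) (fun x => ∑ i ∈ s, χ i x) x = ∑ i ∈ s, mvfderiv (𝓡 k) (χ i) x := by
  classical
  have hd : ∀ i, MDifferentiableAt (𝓡 k) 𝓘(ℝ) (χ i) x := fun i =>
    (hχ i x).mdifferentiableAt (by simp)
  have hds : ∀ s : Finset α, MDifferentiableAt (𝓡 k) 𝓘(ℝ) (fun x => ∑ i ∈ s, χ i x) x :=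
    fun s => (contMDiff_finsetSum (fun i _ => hχ i) x).mdifferentiableAt (by simp)
  induction s using Finset.induction_on with
  | empty =>
    simp only [Finset.sum_empty]
    exact mvfderiv_const (0 : ℝ)
  | insert i s hi ih =>
    simp only [Finset.sum_insert hi]
    rw [mvfderiv_fun_add (hd i) (hds s), ih]

theorem integrableForm_iff_integrableOn {θ : DForm k (Sph k) k} {A : Set (Sph k)}
    (h : ∀ x ∉ A, θ x = 0) : IntegrableForm θ ↔ IntegrableOn (density θ) A (surf k) := by
  refine (integrableOn_iff_integrable_of_support_subset fun x hx => ?_).symm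
  by_contra hxA
  exact hx (by simp [density, h x hxA])

theorem integralForm_eq_setIntegral {θ : DForm k (Sph k) k} {A : Set (Sph k)}
    (h : ∀ x ∉ A, θ x = 0) : integralForm θ = ∫ x in A, density θ x ∂(surf k) :=
  (setIntegral_eq_integral_of_forall_compl_eq_zero fun x hx => by simp [density, h x hx]).symm

/-- Stokes' theorem for `χ η ∧ ξ` on the sphere, with `χ` supported in a coordinate patch,
together with the integrability of the two terms. -/
theorem IsCoord.integralForm_wedge_add {a : ℕ} {p q : ℝ≥0} (hpq : CriticalExponents k p q)
    {c : ℕ} (h : a + a = c) (h' : 1 + c = k) (h'' : a + (a + 1) = k)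
    {ε : ℝ} (hε0 : ε ≠ 0)
    (hε : ∀ {V : Type} [AddCommGroup V] [Module ℝ V]
      (e : Module.Basis (Fin k) ℝ V) (η : V [⋀^Fin a]→ₗ[ℝ] ℝ)
      (D : V →ₗ[ℝ] V [⋀^Fin a]→ₗ[ℝ] ℝ) (v : Fin k → V),
      ∑ i, wedgeAt h' (oneForm (e.coord i)) (wedgeAt h η (D (e i))) v =
        ε * wedgeAt h'' η (AlternatingMap.alternatizeUncurryFin D) v)
    {e : OpenPartialHomeomorph (Sph k) (EuclideanSpace ℝ (Fin k))} (he : IsCoord e)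
    {η ξ : DForm k (Sph k) a} {ζη ζ : DForm k (Sph k) (a + 1)}
    (hη : FormMemW1 p η) (hξ : FormMemW1 p ξ)
    (hζη : HasWeakExtDeriv rfl η ζη) (hζ : HasWeakExtDeriv rfl ξ ζ)
    {χ : Sph k → ℝ} (hχ : ContMDiff (𝓡 k) 𝓘(ℝ) ∞ χ) (hχU : tsupport χ ⊆ coordPatch e) :
    IntegrableForm (fun x => χ x • wedge h'' η ζ x) ∧
    IntegrableForm (wedge h' (dFun χ) (wedge h η ξ)) ∧
    ((∀ᵐ x ∂(surf k), ζη x = 0) →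
      ε * integralForm (fun x => χ x • wedge h'' η ζ x) +
        integralForm (wedge h' (dFun χ) (wedge h η ξ)) = 0) := by
  obtain ⟨χ', hχ's, hχ'c, hχ'U, hχ'⟩ := he.exists_contDiff_read hχ hχU
  obtain ⟨Dη, hDη⟩ := exists_isSobolevForm (W := chartPull e η) (p := p) fun I => hη e he I
  obtain ⟨Dξ, hDξ⟩ := exists_isSobolevForm (W := chartPull e ξ) (p := p) fun I => hξ e he I
  have hdη := hDη.ae_eq_alternatizeUncurryFin (Z := chartPull e ζη) fun J => hζη e he J
  have hdξ := hDξ.ae_eq_alternatizeUncurryFin (Z := chartPull e ζ) fun J => hζ e he J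
  obtain ⟨s, hs, hsθ⟩ := he.exists_integral_eq
  obtain ⟨J1, J2, J3⟩ := IsSobolevForm.integral_wedge_add hpq h h' h'' hε0 hε hDη hDξ
    hχ's hχ'c hχ'U
  set θ₁ : DForm k (Sph k) k := fun x => χ x • wedge h'' η ζ x with hθ₁
  set θ₂ : DForm k (Sph k) k := wedge h' (dFun χ) (wedge h η ξ) with hθ₂
  -- both forms vanish off the patch
  have z1 : ∀ x ∉ coordPatch e, θ₁ x = 0 := fun x hx => by
    have : χ x = 0 := image_eq_zero_of_notMem_tsupport fun hn => hx (hχU hn)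
    simp [hθ₁, this]
  have z2 : ∀ x ∉ coordPatch e, θ₂ x = 0 := fun x hx => by
    have h1 : χ =ᶠ[𝓝 x] fun _ => 0 :=
      notMem_tsupport_iff_eventuallyEq.1 fun hn => hx (hχU hn)
    have h2 : mvfderiv (𝓡 k) χ x = 0 := by
      rw [mvfderiv, h1.mfderiv_eq, mfderiv_const]
      exact ContinuousLinearMap.comp_zero _
    have h3 : dFun χ x = 0 := by
      rw [dFun, h2]; rfl
    have h4 : θ₂ x = wedgeRight h' (wedge h η ξ x) (dFun χ x) := rfl
    rw [h4, h3, map_zero]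
  -- the two forms in the chart
  have e1 : (fun y => coef e θ₁ id y) =ᵐ[volume.restrict (ball 0 1)]
      fun y => χ' y * wedgeAt h'' (chartPull e η y)
        (AlternatingMap.alternatizeUncurryFin (Dξ y)) (stdTuple id) := by
    filter_upwards [hdξ, ae_restrict_mem measurableSet_ball] with y hy hyB
    rw [← hy, ← chartPull_wedge, (hχ' y hyB).self_of_nhds]
    rfl
  have e2 : (fun y => coef e θ₂ id y) =ᵐ[volume.restrict (ball 0 1)]
      fun y => wedgeAt h' (oneForm (fderiv ℝ χ' y).toLinearMap)
        (wedgeAt h (chartPull e η y) (chartPull e ξ y)) (stdTuple id) := by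
    filter_upwards [ae_restrict_mem measurableSet_ball] with y hyB
    rw [coef_eq_chartPull, hθ₂, chartPull_wedge, chartPull_wedge,
      he.chartPull_dFun hχ (he.ball_subset hyB), (hχ' y hyB).fderiv_eq]
  refine ⟨?_, ?_, fun hcl => ?_⟩
  · rw [integrableForm_iff_integrableOn z1, (hsθ θ₁).1]
    exact J1.integrableOn.congr e1.symm
  · rw [integrableForm_iff_integrableOn z2, (hsθ θ₂).1]
    exact J2.integrableOn.congr e2.symm
  · have hcl' : ∀ᵐ y ∂(volume.restrict (ball (0 : EuclideanSpace ℝ (Fin k)) 1)),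
        AlternatingMap.alternatizeUncurryFin (Dη y) = 0 := by
      filter_upwards [hdη, he.ae_of_ae_surf hcl] with y hy1 hy2
      rw [← hy1, chartPull, hy2]
      rfl
    have main := J3 hcl'
    have o1 : ∀ y ∉ ball (0 : EuclideanSpace ℝ (Fin k)) 1, χ' y * wedgeAt h'' (chartPull e η y)
        (AlternatingMap.alternatizeUncurryFin (Dξ y)) (stdTuple id) = 0 := fun y hy => by
      have : χ' y = 0 := image_eq_zero_of_notMem_tsupport fun hn => hy (hχ'U hn)
      rw [this, zero_mul]
    have o2 : ∀ y ∉ ball (0 : EuclideanSpace ℝ (Fin k)) 1,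
        wedgeAt h' (oneForm (fderiv ℝ χ' y).toLinearMap)
        (wedgeAt h (chartPull e η y) (chartPull e ξ y)) (stdTuple id) = 0 := fun y hy => by
      have h1 : fderiv ℝ χ' y = 0 :=
        image_eq_zero_of_notMem_tsupport fun hn => hy (hχ'U (tsupport_fderiv_subset ℝ hn))
      have h2 : oneForm (fderiv ℝ χ' y).toLinearMap = 0 := by rw [h1]; rfl
      have h3 : wedgeAt h' (oneForm (fderiv ℝ χ' y).toLinearMap)
        (wedgeAt h (chartPull e η y) (chartPull e ξ y)) = wedgeRight h' _ _ := rfl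
      rw [h3, h2, map_zero]
      rfl
    rw [integralForm_eq_setIntegral z1, integralForm_eq_setIntegral z2, (hsθ θ₁).2, (hsθ θ₂).2,
      integral_congr_ae e1, integral_congr_ae e2,
      setIntegral_eq_integral_of_forall_compl_eq_zero o1,
      setIntegral_eq_integral_of_forall_compl_eq_zero o2, mul_left_comm, ← mul_add, main, mul_zero]

theorem density_smul (r : Sph k → ℝ) (θ : DForm k (Sph k) k) (x : Sph k) :
    density (fun x => r x • θ x) x = r x * density θ x := by
  simp only [density, AlternatingMap.smul_apply, smul_eq_mul, mul_div_assoc]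

/-- For `η`, `ξ` of class `W^{1,p}` at the critical exponent, `η ∧ dξ` is integrable over the
sphere, and its integral vanishes if `η` is weakly closed. The local formulas of
`IsCoord.integralForm_wedge_add` are added up over a partition of unity. -/
theorem integralForm_wedge_of_criticalExponents {a b : ℕ} {p q : ℝ≥0}
    (hpq : CriticalExponents k p q) (hb : a + 1 = b) (h'' : a + b = k)
    {η ξ : DForm k (Sph k) a} {ζη ζ : DForm k (Sph k) b}
    (hη : FormMemW1 p η) (hξ : FormMemW1 p ξ)
    (hζη : HasWeakExtDeriv hb η ζη) (hζ : HasWeakExtDeriv hb ξ ζ) :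
    IntegrableForm (wedge h'' η ζ) ∧
      ((∀ᵐ x ∂(surf k), ζη x = 0) → integralForm (wedge h'' η ζ) = 0) := by
  subst hb
  obtain ⟨ε, hε0, hε⟩ := exists_sum_wedgeAt_eq (k := k) (a := a) (b := a) (c := a + a) rfl
    (by omega) h''
  obtain ⟨t, χ, hχ, hχU, hχ1⟩ := exists_finite_partition k
  have P := fun i : t => (isCoord_chartAt (i : Sph k)).integralForm_wedge_add hpq rfl (by omega)
    h'' hε0 hε hη hξ hζη hζ (hχ i) (hχU i)
  have hsum : density (wedge h'' η ζ) =
      fun x => ∑ i, density (fun x => χ i x • wedge h'' η ζ x) x := by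
    ext x
    simp only [density_smul]
    rw [← Finset.sum_mul, hχ1, one_mul]
  have hint : IntegrableForm (wedge h'' η ζ) := by
    rw [IntegrableForm, hsum]
    exact integrable_finsetSum _ fun i _ => (P i).1
  refine ⟨hint, fun hcl => ?_⟩
  -- the differentials of the functions of the partition of unity add up to zero
  have hzero : ∀ x, ∑ i, density (wedge (by omega) (dFun (χ i)) (wedge rfl η ξ) :
      DForm k (Sph k) k) x = 0 := by
    intro x
    have h1 : ∑ i, dFun (χ i) x = 0 := by
      have h2 := mvfderiv_sum Finset.univ hχ x
      simp only [hχ1, mvfderiv_const] at h2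
      ext v
      rw [alternatingMap_sum_apply]
      have h3 := congrArg (fun L => L (v 0)) h2
      simp only [sum_apply] at h3
      exact h3.symm
    simp only [density]
    rw [← Finset.sum_div, ← alternatingMap_sum_apply]
    have h4 : ∑ i, (wedge (by omega) (dFun (χ i)) (wedge rfl η ξ) : DForm k (Sph k) k) x =
        wedgeRight (by omega) (wedge rfl η ξ x) (∑ i, dFun (χ i) x) := by
      rw [map_sum]; rfl
    rw [h4, h1, map_zero]
    simp
  have h1 : integralForm (wedge h'' η ζ) =
      ∑ i, integralForm (fun x => χ i x • wedge h'' η ζ x) := by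
    simp only [integralForm]
    rw [hsum, integral_finsetSum _ fun i _ => (P i).1]
  have h2 : ∑ i, integralForm (wedge (by omega) (dFun (χ i)) (wedge rfl η ξ) :
      DForm k (Sph k) k) = 0 := by
    simp only [integralForm]
    rw [← integral_finsetSum _ fun i _ => (P i).2.1]
    simp only [hzero, integral_zero]
  have h3 : ε * integralForm (wedge h'' η ζ) = 0 := by
    have h4 := Finset.sum_eq_zero fun i (_ : i ∈ Finset.univ) => (P i).2.2 hcl
    rw [Finset.sum_add_distrib, h2, add_zero, ← Finset.mul_sum, ← h1] at h4
    exact h4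
  exact (mul_eq_zero.1 h3).resolve_left hε0

/-! ### Dependence of the integral on the exterior derivative -/

theorem wedge_sub_left {a b c : ℕ} (h : a + b = c) (w w' : DForm k (Sph k) a)
    (ζ : DForm k (Sph k) b) (x : Sph k) :
    wedge h (fun x => w x - w' x) ζ x = wedge h w ζ x - wedge h w' ζ x :=
  map_sub (wedgeRight h (ζ x)) (w x) (w' x)

/-- The critical exponents in dimension `k = 2a + 1` are `p = k / (a + 1)` and `q = k / a`. For
`k = 4n - 1` and `a = 2n - 1` this is `p = 2 - 1 / (2n)`. -/
theorem criticalExponents {a : ℕ} (ha : 1 ≤ a) (hk : a + (a + 1) = k) :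
    CriticalExponents k ((k : ℝ≥0) / (a + 1)) ((k : ℝ≥0) / a) := by
  have ha' : (0 : ℝ≥0) < a := by exact_mod_cast ha
  have hkv : (k : ℝ≥0) = a + (a + 1) := by exact_mod_cast hk.symm
  have hk0 : (0 : ℝ≥0) < k := by rw [hkv]; positivity
  refine ⟨by omega, ?_, ?_, ?_⟩
  · rw [one_le_div (by positivity), hkv]
    exact le_add_self
  · refine NNReal.HolderConjugate.coe_ennreal ?_
    rw [NNReal.holderConjugate_iff]
    refine ⟨?_, ?_⟩
    · rw [one_lt_div (by positivity), hkv]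
      exact lt_add_of_pos_left _ ha'
    · rw [inv_div, inv_div, ← add_div, hkv, div_eq_one_iff_eq (by positivity)]
      ring
  · have hkr : (k : ℝ) ≠ 0 := by exact_mod_cast hk0.ne'
    push_cast
    rw [inv_div, inv_div, inv_eq_one_div, ← sub_div, add_sub_cancel_right]

/-- The integral of `w ∧ dw` depends only on `dw`: if `dw₁ = dw₂`, then
`w₁ ∧ dw₁ - w₂ ∧ dw₂ = (w₁ - w₂) ∧ dw₁`, and `w₁ - w₂` is closed. -/
theorem integralForm_wedge_eq_of_ae_eq {a b : ℕ} (ha : 1 ≤ a) (hb : a + 1 = b) (h : a + b = k)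
    {p : ℝ≥0∞} (hp : (((k : ℝ≥0) / (a + 1) : ℝ≥0) : ℝ≥0∞) ≤ p)
    {w₁ w₂ : DForm k (Sph k) a} {dw₁ dw₂ : DForm k (Sph k) b}
    (hw₁ : FormMemW1 p w₁) (hw₂ : FormMemW1 p w₂)
    (hd₁ : HasWeakExtDeriv hb w₁ dw₁) (hd₂ : HasWeakExtDeriv hb w₂ dw₂)
    (hd : ∀ᵐ x ∂(surf k), dw₁ x = dw₂ x) :
    IntegrableForm (wedge h w₁ dw₁) ∧ IntegrableForm (wedge h w₂ dw₂) ∧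
      integralForm (wedge h w₁ dw₁) = integralForm (wedge h w₂ dw₂) := by
  have hpq := criticalExponents (k := k) ha (by omega)
  have m₁ := hw₁.mono_exponent hp
  have m₂ := hw₂.mono_exponent hp
  have i₁ := (integralForm_wedge_of_criticalExponents hpq hb h m₁ m₁ hd₁ hd₁).1
  have i₂ := (integralForm_wedge_of_criticalExponents hpq hb h m₂ m₂ hd₂ hd₂).1
  have h0 := (integralForm_wedge_of_criticalExponents hpq hb h (m₁.sub m₂) m₁ (hd₁.sub hd₂)
    hd₁).2 (by filter_upwards [hd] with x hx; rw [hx, sub_self])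
  refine ⟨i₁, i₂, ?_⟩
  rw [← sub_eq_zero, ← h0]
  simp only [integralForm]
  rw [← integral_sub i₁ i₂]
  refine integral_congr_ae ?_
  filter_upwards [hd] with x hx
  have h1 : wedge h w₂ dw₂ x = wedge h w₂ dw₁ x := by
    rw [wedge_apply, wedge_apply, hx]
  simp only [density, wedge_sub_left, h1, AlternatingMap.sub_apply, sub_div]

end SobolevForms

theorem proposition5p4 (n : ℕ) (hn : 1 ≤ n) (p : ℝ≥0∞)
    (hp : ENNReal.ofReal (2 - 1 / (2 * (n : ℝ))) ≤ p) :
    (∀ (ω₁ ω₂ : DForm (4 * n - 1) (Sph (4 * n - 1)) (2 * n - 1))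
        (dω₁ dω₂ : DForm (4 * n - 1) (Sph (4 * n - 1)) (2 * n)),
      FormMemW1 p ω₁ → FormMemW1 p ω₂ →
      HasWeakExtDeriv (by omega) ω₁ dω₁ → HasWeakExtDeriv (by omega) ω₂ dω₂ →
      (∀ᵐ x ∂(surf (4 * n - 1)), dω₁ x = dω₂ x) →
      IntegrableForm (wedge (by omega) ω₁ dω₁) ∧
      IntegrableForm (wedge (by omega) ω₂ dω₂) ∧
      integralForm (wedge (by omega) ω₁ dω₁) = integralForm (wedge (by omega) ω₂ dω₂)) ∧
    (∀ (m : ℕ) (f : Sph (4 * n - 1) → EuclideanSpace ℝ (Fin m)) (K : ℝ≥0)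
        (α : EuclideanSpace ℝ (Fin m) → EuclideanSpace ℝ (Fin m) [⋀^Fin (2 * n)]→L[ℝ] ℝ),
      LipschitzWith K f →
      (∀ᵐ x ∂(surf (4 * n - 1)),
        (mvfderiv (𝓡 (4 * n - 1)) f x).toLinearMap.rank ≤ ((2 * n : ℕ) : Cardinal)) →
      ContDiff ℝ ∞ α →
      ∀ ω₁ ω₂ : DForm (4 * n - 1) (Sph (4 * n - 1)) (2 * n - 1),
        FormMemW1 p ω₁ → FormMemW1 p ω₂ →
        HasWeakExtDeriv (by omega) ω₁ (pullback f α) →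
        HasWeakExtDeriv (by omega) ω₂ (pullback f α) →
        IntegrableForm (wedge (by omega) ω₁ (pullback f α)) ∧
        IntegrableForm (wedge (by omega) ω₂ (pullback f α)) ∧
        integralForm (wedge (by omega) ω₁ (pullback f α)) =
          integralForm (wedge (by omega) ω₂ (pullback f α))) := by
  have hn' : (0 : ℝ) < n := by exact_mod_cast hn
  have hp' : ((((4 * n - 1 : ℕ) : ℝ≥0) / ((2 * n - 1 : ℕ) + 1) : ℝ≥0) : ℝ≥0∞) ≤ p := by
    refine le_trans (le_of_eq ?_) hp
    rw [ENNReal.ofReal, ENNReal.coe_inj]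
    ext
    have h1 : ((4 * n - 1 : ℕ) : ℝ) = 4 * n - 1 := by
      rw [Nat.cast_sub (by omega)]; push_cast; ring
    have h2 : ((2 * n - 1 : ℕ) : ℝ) = 2 * n - 1 := by
      rw [Nat.cast_sub (by omega)]; push_cast; ring
    -- the lower bound on `p` is exactly the critical exponent
    have h3 : (2 : ℝ) - 1 / (2 * (n : ℝ)) = (4 * n - 1) / (2 * n) := by
      field_simp; ring
    have h4 : (1 : ℝ) ≤ n := by exact_mod_cast hn
    rw [Real.coe_toNNReal _ (by rw [h3]; exact div_nonneg (by linarith) (by linarith)), h3]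
    rw [NNReal.coe_div, NNReal.coe_add, NNReal.coe_one, NNReal.coe_natCast, NNReal.coe_natCast,
      h1, h2, sub_add_cancel]
  refine ⟨fun ω₁ ω₂ dω₁ dω₂ hω₁ hω₂ hd₁ hd₂ hd => ?_,
    fun m f K α _ _ _ ω₁ ω₂ hω₁ hω₂ hd₁ hd₂ => ?_⟩
  · exact integralForm_wedge_eq_of_ae_eq (by omega) (by omega) (by omega) hp' hω₁ hω₂ hd₁ hd₂ hd
  · exact integralForm_wedge_eq_of_ae_eq (by omega) (by omega) (by omega) hp' hω₁ hω₂ hd₁ hd₂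
      (.of_forall fun _ => rfl)
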